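/- **Theorem 3.1.** A tournament is a loopless digraph in which, for any two distinct vertices $u,v$, exactly one of $uv$ and $vu$ is an edge. An oriented tree is a finite digraph with at most one edge between any two vertices whose underlying undirected graph is a tree; its leaves are its vertices of degree $1$ in the underlying graph. A bare path of an oriented tree $T$ is a path in the underlying graph of $T$ all of whose internal vertices have degree $2$ in the underlying graph; it is directed if its edges are all oriented from one of its ends towards the other. Let $n,k$ be non-negative integers. Then every tournament with $n+50k$ vertices contains a copy of every oriented tree with $n$ vertices and $k$ leaves in which every bare path is directed; that is, there is an injective map from the vertices of the tree to the vertices of the tournament that maps each edge $uv$ of the tree to an edge of the tournament with the same orientation. -/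

import Mathlib

namespace Digraph

/-- The underlying (undirected, simple) graph of a digraph. -/
abbrev underlying {V : Type*} (D : Digraph V) : SimpleGraph V := D.toSimpleGraphInclusive

/-- An oriented graph: no loops, and at most one edge between any two vertices
(taking `u = v` shows that there are no loops). -/
def IsOrientedGraph {V : Type*} (D : Digraph V) : Prop :=
  ∀ u v : V, D.Adj u v → ¬ D.Adj v u

/-- An oriented tree: an oriented graph whose underlying graph is a tree. -/
def IsOrientedTree {V : Type*} (D : Digraph V) : Prop :=
  D.IsOrientedGraph ∧ D.underlying.IsTree

/-- A tournament: a loopless digraph in which, for any two distinct vertices `u` and `v`,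
exactly one of `uv` and `vu` is an edge. -/
def IsTournament {V : Type*} (D : Digraph V) : Prop :=
  (∀ v : V, ¬ D.Adj v v) ∧ ∀ u v : V, u ≠ v → (D.Adj u v ↔ ¬ D.Adj v u)

/-- The degree of a vertex in the underlying graph (for finite vertex sets). -/
noncomputable def underlyingDegree {V : Type*} (D : Digraph V) (v : V) : ℕ :=
  (D.underlying.neighborSet v).ncard

/-- The leaves: the vertices whose degree in the underlying graph is one. -/
def leaves {V : Type*} (D : Digraph V) : Set V :=
  {v | D.underlyingDegree v = 1}

/-- A bare path: a path (with no condition on the directions of its edges) all of whose internal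
vertices have degree two in the whole digraph. -/
def IsBarePath {V : Type*} (D : Digraph V) {u w : V} (p : D.underlying.Walk u w) : Prop :=
  p.IsPath ∧ ∀ x ∈ p.support, x ≠ u → x ≠ w → D.underlyingDegree x = 2

/-- A directed path: the edges are all directed from the first vertex towards the last one, or all
directed from the last vertex towards the first one. -/
def IsDirectedPath {V : Type*} (D : Digraph V) {u w : V} (p : D.underlying.Walk u w) : Prop :=
  p.IsPath ∧ ((∀ d ∈ p.darts, D.Adj d.fst d.snd) ∨ (∀ d ∈ p.darts, D.Adj d.snd d.fst))

/-- `G` contains a copy of `D`: there is an injection of vertices that maps every edge of `D` to an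
edge of `G`. -/
def ContainsCopy {V W : Type*} (G : Digraph W) (D : Digraph V) : Prop :=
  ∃ f : V → W, Function.Injective f ∧ ∀ u v : V, D.Adj u v → G.Adj (f u) (f v)

end Digraph

/-! Order the tournament so that as many edges as possible point forward. In such a median order
every vertex sends edges to at least half of each interval right behind it and receives edges from
at least half of each interval right before it.

Since bare paths are directed, each vertex of degree two has one in- and one out-neighbour, so these
vertices form directed runs. Let `L` be the union of the runs with at least two vertices. For a tree
with at least two vertices, counting degrees and edges shows that the vertices outside `L` and the
runs in `L` together number at most `4 * k - 5`. A level that rises by one on each edge entering `L`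
splits the vertices outside `L` into forests `K t`, and each run leads from `K t` to `K (t + 1)`.

Each `K t` is embedded sparsely into a block of four times its size (`exists_sparse_embedding`). The
runs between two blocks become disjoint directed paths (`exists_isPathSystem`): a scan from left to
right gives each free position to the path with the earliest current end that has an edge to it, and
the median order limits how many positions are skipped. The last two interior vertices come from
`exists_path_three`, which reaches a prescribed target despite obstacles. A run costs 11 positions
beyond its length and a vertex outside `L` costs 11 beyond itself, so `11 * (4 * k - 5)` extra
positions suffice. -/

open Finset Classical

/-! ### Median orders and their existence. -/

/-- A tournament on `ℕ` whose natural order is a median order: moving the elements of `Y` behind the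
other elements of an interval does not increase the number of forward edges. -/
structure IsMedianOrder (E : ℕ → ℕ → Prop) : Prop where
  asymm : ∀ a b, E a b → ¬ E b a
  total : ∀ a b, a ≠ b → E a b ∨ E b a
  move : ∀ (s v : ℕ) (Y : Finset ℕ),
    #{z ∈ Ico s v ×ˢ Ico s v | z.1 ∈ Y ∧ z.2 ∉ Y ∧ z.1 < z.2 ∧ E z.2 z.1} ≤
      #{z ∈ Ico s v ×ˢ Ico s v | z.1 ∈ Y ∧ z.2 ∉ Y ∧ z.1 < z.2 ∧ E z.1 z.2}

namespace IsMedianOrder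

variable {E : ℕ → ℕ → Prop}

/-- Moving `i` alone to the end of `[i, v)` reverses exactly the pairs that contain `i`. -/
theorem card_in_le_card_out (hE : IsMedianOrder E) (i v : ℕ) :
    #{x ∈ Ioo i v | E x i} ≤ #{x ∈ Ioo i v | E i x} := by
  refine le_trans (card_le_card_of_injOn (fun x => (i, x)) ?_ ?_)
    (le_trans (hE.move i v {i}) (card_le_card_of_injOn Prod.snd ?_ ?_))
  · intro x hx
    simp at hx ⊢
    exact ⟨by omega, by omega, by omega, hx.2⟩
  · intro a _ b _ h
    simpa using h
  · rintro ⟨a, b⟩ hx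
    simp at hx ⊢
    obtain ⟨h1, rfl, h2, h3, h4⟩ := hx
    exact ⟨by omega, h4⟩
  · rintro ⟨a, b⟩ hx ⟨a', b'⟩ hx' h
    simp at hx hx' h ⊢
    omega

/-- Moving all of `[q, g)` behind `g` amounts to moving `g` to the front. -/
theorem card_out_le_card_in (hE : IsMedianOrder E) (q g : ℕ) :
    #{x ∈ Ico q g | E g x} ≤ #{x ∈ Ico q g | E x g} := by
  refine le_trans (card_le_card_of_injOn (fun x => (x, g)) ?_ ?_)
    (le_trans (hE.move q (g + 1) (Ico q g)) (card_le_card_of_injOn Prod.fst ?_ ?_))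
  · intro x hx
    simp at hx ⊢
    refine ⟨by omega, by omega, by omega, hx.2⟩
  · intro a _ b _ h
    simpa using h
  · rintro ⟨a, b⟩ hx
    simp at hx ⊢
    obtain ⟨h1, h2, h3, h4, h5⟩ := hx
    obtain rfl : b = g := by omega
    exact ⟨by omega, h5⟩
  · rintro ⟨a, b⟩ hx ⟨a', b'⟩ hx' h
    simp at hx hx' h ⊢
    omega

/-- A vertex sends edges to at least half of the vertices in an interval after it. -/
theorem le_two_mul_card_out (hE : IsMedianOrder E) (i v : ℕ) :
    v - i - 1 ≤ 2 * #{x ∈ Ioo i v | E i x} := by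
  have h1 := hE.card_in_le_card_out i v
  have h2 : #(Ioo i v) ≤ #{x ∈ Ioo i v | E x i} + #{x ∈ Ioo i v | E i x} := by
    rw [← card_union_of_disjoint]
    · refine card_le_card fun x hx => ?_
      simp at hx ⊢
      rcases hE.total x i (by omega) with h | h <;> simp [h, hx]
    · rw [disjoint_filter]
      exact fun x _ => hE.asymm _ _
  simp at h2
  omega

/-- A vertex receives edges from at least half of the vertices in an interval before it. -/
theorem le_two_mul_card_in (hE : IsMedianOrder E) (q g : ℕ) :
    g - q ≤ 2 * #{x ∈ Ico q g | E x g} := by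
  have h1 := hE.card_out_le_card_in q g
  have h2 : #(Ico q g) ≤ #{x ∈ Ico q g | E g x} + #{x ∈ Ico q g | E x g} := by
    rw [← card_union_of_disjoint]
    · refine card_le_card fun x hx => ?_
      simp at hx ⊢
      rcases hE.total x g (by omega) with h | h <;> simp [h, hx]
    · rw [disjoint_filter]
      exact fun x _ => hE.asymm _ _
  simp at h2
  omega

end IsMedianOrder

/-- The vertices of a finite digraph have an ordering with the most forward edges. -/
theorem Digraph.exists_max_forward {W : Type*} [Fintype W] (G : Digraph W) :
    ∃ p : W → ℕ, Function.Injective p ∧ ∀ p' : W → ℕ, Function.Injective p' →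
      #{z : W × W | G.Adj z.1 z.2 ∧ p' z.1 < p' z.2} ≤
        #{z : W × W | G.Adj z.1 z.2 ∧ p z.1 < p z.2} := by
  let S : Set ℕ := {m | ∃ p : W → ℕ, Function.Injective p ∧
    #{z : W × W | G.Adj z.1 z.2 ∧ p z.1 < p z.2} = m}
  have hb : BddAbove S := by
    refine ⟨Fintype.card (W × W), ?_⟩
    rintro m ⟨p, _, rfl⟩
    exact card_le_univ _
  have hne : S.Nonempty :=
    ⟨_, fun w => (Fintype.equivFin W w : ℕ),
      Fin.val_injective.comp (Fintype.equivFin W).injective, rfl⟩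
  obtain ⟨p, hp, hm⟩ := Nat.sSup_mem hne hb
  exact ⟨p, hp, fun p' hp' => hm ▸ le_csSup hb ⟨p', hp', rfl⟩⟩

/-- Every finite tournament has a median order; here it is extended to a tournament on `ℕ`. -/
theorem Digraph.IsTournament.exists_isMedianOrder {W : Type*} [Fintype W] {G : Digraph W}
    (hG : G.IsTournament) :
    ∃ (E : ℕ → ℕ → Prop), IsMedianOrder E ∧ ∃ e : Fin (Fintype.card W) → W,
      Function.Injective e ∧ ∀ a b : Fin (Fintype.card W), E a b → G.Adj (e a) (e b) := by
  obtain ⟨p, hp, hmax⟩ := G.exists_max_forward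
  set N := Fintype.card W with hN
  obtain ⟨e, he⟩ : ∃ e : Fin N ≃ W, ∀ a b, p (e a) < p (e b) ↔ a < b := by
    let _ := LinearOrder.lift' p hp
    let i := monoEquivOfFin W hN.symm
    exact ⟨i.toEquiv, fun a b => i.lt_iff_lt⟩
  have hes : ∀ a b, p a < p b ↔ e.symm a < e.symm b := fun a b => by
    simpa using he (e.symm a) (e.symm b)
  have hadj : ∀ a b, a ≠ b → (G.Adj a b ↔ ¬ G.Adj b a) := hG.2
  -- Every pair not inside `[0, N)` is a forward edge, so the extension creates no new backward
  -- edges.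
  obtain ⟨E, hE, hE'⟩ : ∃ E : ℕ → ℕ → Prop,
      (∀ a b (ha : a < N) (hb : b < N), E a b ↔ G.Adj (e ⟨a, ha⟩) (e ⟨b, hb⟩)) ∧
      ∀ a b, ¬ (a < N ∧ b < N) → (E a b ↔ a < b) :=
    ⟨fun a b => if h : a < N ∧ b < N then G.Adj (e ⟨a, h.1⟩) (e ⟨b, h.2⟩) else a < b,
      fun a b ha hb => by simp [ha, hb], fun a b h => by simp only [h, dite_false]⟩
  refine ⟨E, ⟨?_, ?_, ?_⟩, e, e.injective, fun a b h => by simpa using (hE a b a.2 b.2).1 h⟩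
  · intro a b h h'
    by_cases hab : a < N ∧ b < N
    · rw [hE a b hab.1 hab.2] at h
      rw [hE b a hab.2 hab.1] at h'
      by_cases hne : a = b
      · subst hne
        exact hG.1 _ h
      · exact (hadj _ _ (by simpa using hne)).1 h h'
    · rw [hE' _ _ hab] at h
      rw [hE' _ _ (by tauto)] at h'
      omega
  · intro a b hne
    by_cases hab : a < N ∧ b < N
    · rw [hE a b hab.1 hab.2, hE b a hab.2 hab.1]
      have := hadj (e ⟨a, hab.1⟩) (e ⟨b, hab.2⟩) (by simpa using hne)
      tauto
    · rw [hE' _ _ hab, hE' _ _ (by tauto)]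
      omega
  · intro s v Y
    let pos : W → ℕ := fun w => (e.symm w : ℕ)
    have hpos : ∀ w, pos w < N := fun w => (e.symm w).2
    have hinj : ∀ a b, pos a = pos b → a = b := fun a b h =>
      e.symm.injective (Fin.ext h)
    have hpp : ∀ a b, p a < p b ↔ pos a < pos b := fun a b => hes a b
    have hEp : ∀ a b, E (pos a) (pos b) ↔ G.Adj a b := fun a b => by
      rw [hE _ _ (hpos a) (hpos b)]; simp [pos]
    -- As positions are below `N`, the shifts by `N` and `2 * N` put the part of `Y` in `[s, v)`
    -- behind the rest of `[s, v)` and before everything from `v` on.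
    let key : W → ℕ := fun w =>
      if pos w < s then pos w else if pos w < v then
        (if pos w ∈ Y then pos w + N else pos w) else pos w + 2 * N
    have hkey : Function.Injective key := by
      intro a b h
      apply hinj
      have h1 := hpos a
      have h2 := hpos b
      simp only [key] at h
      split_ifs at h <;> omega
    have hle := hmax key hkey
    let FP : Finset (W × W) := {z | s ≤ pos z.1 ∧ pos z.2 < v ∧ pos z.1 ∈ Y ∧ pos z.2 ∉ Y ∧
      pos z.1 < pos z.2 ∧ G.Adj z.1 z.2}
    let BP : Finset (W × W) := {z | s ≤ pos z.2 ∧ pos z.1 < v ∧ pos z.2 ∈ Y ∧ pos z.1 ∉ Y ∧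
      pos z.2 < pos z.1 ∧ G.Adj z.1 z.2}
    -- The reordering loses only the forward edges in `FP` and gains those in `BP`.
    have hsub : ({z : W × W | G.Adj z.1 z.2 ∧ p z.1 < p z.2} : Finset _) \ FP ∪ BP ⊆
        ({z : W × W | G.Adj z.1 z.2 ∧ key z.1 < key z.2} : Finset _) := by
      rintro ⟨a, b⟩ hz
      have h1 := hpos a
      have h2 := hpos b
      simp only [mem_union, mem_sdiff, mem_filter, mem_univ, true_and, FP, BP, hpp] at hz ⊢
      rcases hz with ⟨⟨hz, hlt⟩, hn⟩ | ⟨hs, hv, hy, hy', hlt, hz⟩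
      · refine ⟨hz, ?_⟩
        simp only [key]
        have : ¬ (s ≤ pos a ∧ pos b < v ∧ pos a ∈ Y ∧ pos b ∉ Y) := by tauto
        split_ifs <;> first | omega | (exfalso; apply this; refine ⟨?_, ?_, ?_, ?_⟩ <;> first | assumption | omega)
      · refine ⟨hz, ?_⟩
        simp only [key]
        rw [if_neg (by omega), if_pos hv, if_neg hy', if_neg (by omega), if_pos (by omega),
          if_pos hy]
        omega
    have hdisj : Disjoint (({z : W × W | G.Adj z.1 z.2 ∧ p z.1 < p z.2} : Finset _) \ FP) BP := by
      rw [disjoint_left]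
      rintro ⟨a, b⟩ hz hz'
      simp only [mem_sdiff, mem_filter, mem_univ, true_and, BP, hpp] at hz hz'
      omega
    have hBF : #BP ≤ #FP := by
      have h1 := card_le_card hsub
      rw [card_union_of_disjoint hdisj] at h1
      have h2 := le_card_sdiff FP ({z : W × W | G.Adj z.1 z.2 ∧ p z.1 < p z.2} : Finset _)
      omega
    refine le_trans ?_ (hBF.trans ?_)
    · by_cases hW : IsEmpty W
      · have h0 : N = 0 := by rw [hN]; exact Fintype.card_eq_zero
        rw [card_eq_zero.2]
        · exact Nat.zero_le _
        · rw [filter_eq_empty_iff]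
          rintro ⟨a, b⟩ _ ⟨_, _, hlt, hba⟩
          rw [hE' _ _ (by omega)] at hba
          simp at hlt hba
          omega
      · rw [not_isEmpty_iff] at hW
        obtain ⟨w0⟩ := hW
        let w : ℕ → W := fun a => if h : a < N then e ⟨a, h⟩ else w0
        have hw : ∀ a, a < N → pos (w a) = a := fun a ha => by simp [pos, w, ha]
        have hlt : ∀ a b, a < b → E b a → b < N := fun a b hab hba => by
          by_contra hb
          rw [hE' _ _ (by omega)] at hba
          omega
        refine card_le_card_of_injOn (fun z => (w z.2, w z.1)) ?_ ?_
        · rintro ⟨a, b⟩ hz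
          simp only [coe_filter, mem_product, mem_Ico, Set.mem_ofPred_eq] at hz
          obtain ⟨⟨⟨h1, h2⟩, h3, h4⟩, h5, h6, h7, h8⟩ := hz
          have hb := hlt a b h7 h8
          have ha : a < N := h7.trans hb
          simp only [BP, coe_filter, Set.mem_ofPred_eq, mem_univ, true_and, ← hEp, hw a ha, hw b hb]
          exact ⟨h1, h4, h5, h6, h7, h8⟩
        · rintro ⟨a, b⟩ hz ⟨a', b'⟩ hz' h
          simp only [coe_filter, mem_product, mem_Ico, Set.mem_ofPred_eq] at hz hz'
          have hb := hlt a b hz.2.2.2.1 hz.2.2.2.2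
          have hb' := hlt a' b' hz'.2.2.2.1 hz'.2.2.2.2
          simp only [Prod.mk.injEq] at h
          have e1 := congrArg pos h.1
          have e2 := congrArg pos h.2
          rw [hw _ hb, hw _ hb'] at e1
          rw [hw _ (by omega), hw _ (by omega)] at e2
          simp [e1, e2]
    · refine card_le_card_of_injOn (fun z => (pos z.1, pos z.2)) ?_ ?_
      · rintro ⟨a, b⟩ hz
        simp only [FP, coe_filter, Set.mem_ofPred_eq, mem_univ, true_and] at hz
        simp only [coe_filter, mem_product, mem_Ico, Set.mem_ofPred_eq, hEp]
        refine ⟨⟨⟨hz.1, ?_⟩, ?_, hz.2.1⟩, hz.2.2⟩ <;> omega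
      · rintro ⟨a, b⟩ _ ⟨a', b'⟩ _ h
        simp only [Prod.mk.injEq] at h
        rw [hinj _ _ h.1, hinj _ _ h.2]

/-! ### Cuts and directed paths of length three. -/

theorem exists_leftmost_argmin (F : ℕ → ℤ) {s g : ℕ} (hsg : s ≤ g) :
    ∃ v ∈ Icc s g, (∀ u ∈ Icc s g, F v ≤ F u) ∧ ∀ u ∈ Icc s g, u < v → F v < F u := by
  obtain ⟨m, hm, hmin⟩ := exists_min_image (Icc s g) F ⟨s, by simp [hsg]⟩
  let A : Finset ℕ := {u ∈ Icc s g | F u = F m}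
  have hA : A.Nonempty := ⟨m, by simpa [A] using hm⟩
  have hv := A.min'_mem hA
  simp only [A, mem_filter] at hv
  refine ⟨A.min' hA, hv.1, fun u hu => hv.2 ▸ hmin u hu, fun u hu hlt => ?_⟩
  refine lt_of_le_of_ne (hv.2 ▸ hmin u hu) fun h => ?_
  have : A.min' hA ≤ u := A.min'_le u (by simp only [A, mem_filter]; exact ⟨hu, by rw [← h, hv.2]⟩)
  omega

namespace IsMedianOrder

variable {E : ℕ → ℕ → Prop}

/-- `move` for a set of forward and a set of backward pairs. -/
theorem sum_card_le_sum_card (hE : IsMedianOrder E) {s v : ℕ} {Y Z R : Finset ℕ}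
    (hZ : ∀ z ∈ Z, z ∉ Y) (hZY : ∀ y ∈ Y, ∀ z ∈ Z, E z y)
    (hR : ∀ x ∈ Ico s v, x ∉ Y → x ∉ Z → x ∈ R) :
    ∑ y ∈ Y with y ∈ Ico s v, #{z ∈ Z | y < z ∧ z < v} ≤
      ∑ y ∈ Y with y ∈ Ico s v, #{z ∈ R | y < z ∧ z < v} := by
  rw [← card_sigma, ← card_sigma]
  refine le_trans (card_le_card_of_injOn (fun z => (z.1, z.2)) ?_ ?_)
    (le_trans (hE.move s v Y) (card_le_card_of_injOn (fun z => ⟨z.1, z.2⟩) ?_ ?_))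
  · rintro ⟨a, b⟩ hz
    simp only [coe_sigma, Set.mem_sigma_iff, coe_filter, Set.mem_ofPred_eq, mem_Ico,
      mem_product] at hz ⊢
    obtain ⟨⟨h1, h2, h3⟩, h4, h5, h6⟩ := hz
    exact ⟨⟨⟨h2, h3⟩, by omega, h6⟩, h1, hZ _ h4, h5, hZY _ h1 _ h4⟩
  · rintro ⟨a, b⟩ _ ⟨a', b'⟩ _ h
    simpa using h
  · rintro ⟨a, b⟩ hz
    simp only [coe_sigma, Set.mem_sigma_iff, coe_filter, Set.mem_ofPred_eq, mem_Ico,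
      mem_product] at hz ⊢
    obtain ⟨⟨⟨h1, h2⟩, h3, h4⟩, h5, h6, h7, h8⟩ := hz
    refine ⟨⟨h5, h1, h2⟩, hR b (by simp; omega) h6 fun hb => ?_, h7, h4⟩
    exact hE.asymm _ _ h8 (hZY _ h5 _ hb)
  · rintro ⟨a, b⟩ _ ⟨a', b'⟩ _ h
    simpa using h

/-- If all edges between `Y` and `Z` go from `Z` to `Y`, then some initial part of the interval avoids
`Y`, and behind it `Z` is at most as large as the rest. -/
theorem exists_cut (hE : IsMedianOrder E) {s g : ℕ} (hsg : s ≤ g) {Y Z : Finset ℕ}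
    (hYs : Y ⊆ Ico s g) (hZs : Z ⊆ Ico s g)
    (hZ : ∀ z ∈ Z, z ∉ Y) (hZY : ∀ y ∈ Y, ∀ z ∈ Z, E z y) :
    ∃ v ∈ Icc s g, (∀ y ∈ Y, v ≤ y) ∧
      #{x ∈ Z | v ≤ x} ≤ #{x ∈ Ico s g \ (Y ∪ Z) | v ≤ x} := by
  set R : Finset ℕ := Ico s g \ (Y ∪ Z) with hRdef
  -- The cut is the leftmost minimum of `F`; comparison with `F g = 0` gives the bound on `Z`.
  let F : ℕ → ℤ := fun v => (#{x ∈ Z | v ≤ x} : ℤ) - #{x ∈ R | v ≤ x}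
  obtain ⟨v, hv, hmin, hlt⟩ := exists_leftmost_argmin F hsg
  rw [mem_Icc] at hv
  have hsplit : ∀ (A : Finset ℕ) (y : ℕ), y < v →
      #{x ∈ A | y + 1 ≤ x} = #{x ∈ A | y < x ∧ x < v} + #{x ∈ A | v ≤ x} := by
    intro A y hy
    rw [← card_union_of_disjoint]
    · congr 1
      ext x
      simp only [mem_filter, mem_union]
      constructor
      · rintro ⟨h1, h2⟩
        by_cases x < v
        · left; exact ⟨h1, by omega, by omega⟩
        · right; exact ⟨h1, by omega⟩
      · rintro (⟨h1, h2⟩ | ⟨h1, h2⟩)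
        · exact ⟨h1, by omega⟩
        · exact ⟨h1, by omega⟩
    · rw [disjoint_filter]
      intro x _ h1 h2
      omega
  have hFsplit : ∀ y < v, F (y + 1) - F v =
      (#{x ∈ Z | y < x ∧ x < v} : ℤ) - #{x ∈ R | y < x ∧ x < v} := by
    intro y hy
    simp only [F, hsplit Z y hy, hsplit R y hy]
    push_cast
    ring
  have hsum := hE.sum_card_le_sum_card (s := s) (v := v) (R := R) hZ hZY (fun x hx hxY hxZ => by
    rw [mem_Ico] at hx
    simp only [hRdef, mem_sdiff, mem_union, not_or, mem_Ico]
    exact ⟨by omega, hxY, hxZ⟩)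
  -- Minimality at `v` gives this inequality term by term, while `hsum` gives the reverse for the
  -- sums. So equality holds for each `y ∈ Y` before `v`, that is, `F (y + 1) = F v`.
  have hnn : ∀ y ∈ ({y ∈ Y | y ∈ Ico s v} : Finset ℕ),
      #{x ∈ R | y < x ∧ x < v} ≤ #{x ∈ Z | y < x ∧ x < v} := by
    intro y hy
    rw [mem_filter, mem_Ico] at hy
    have h1 := hFsplit y hy.2.2
    have h2 := hmin (y + 1) (by rw [mem_Icc]; omega)
    omega
  have hYempty : ∀ y ∈ Y, v ≤ y := by
    intro y hy
    by_contra hyv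
    have hyI : y ∈ Ico s g := hYs hy
    rw [mem_Ico] at hyI
    have heq := (sum_eq_sum_iff_of_le hnn).1 (le_antisymm (sum_le_sum hnn) hsum) y (by
      rw [mem_filter, mem_Ico]; exact ⟨hy, by omega, by omega⟩)
    have h1 := hFsplit y (by omega)
    rw [heq, sub_self] at h1
    have h2 : y + 1 = v := by
      by_contra h3
      have := hlt (y + 1) (by rw [mem_Icc]; omega) (by omega)
      omega
    have h3 := hlt y (by rw [mem_Icc]; omega) (by omega)
    -- A vertex of `Y` is counted neither in `Z` nor in `R`; this contradicts the choice of the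
    -- leftmost minimum.
    have h4 : F y = F (y + 1) := by
      have : ∀ A : Finset ℕ, y ∉ A → #{x ∈ A | y ≤ x} = #{x ∈ A | y + 1 ≤ x} := by
        intro A hA
        congr 1
        apply filter_congr
        intro x hx
        have : x ≠ y := fun e => hA (e ▸ hx)
        omega
      simp only [F]
      rw [this Z (fun h => hZ y h hy),
        this R (fun h => (mem_sdiff.1 h).2 (mem_union_left _ hy))]
    omega
  refine ⟨v, by rw [mem_Icc]; exact hv, hYempty, ?_⟩
  have h1 := hmin g (by rw [mem_Icc]; omega)
  have h2 : F g = 0 := by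
      simp only [F]
      rw [filter_false_of_mem, filter_false_of_mem]
      · simp
      · intro x hx
        have := (mem_sdiff.1 hx).1
        rw [mem_Ico] at this; omega
      · intro x hx
        have := hZs hx
        rw [mem_Ico] at this; omega
  simp only [h2, F] at h1
  omega

/-- Between two vertices that are far apart there is a directed path with two interior vertices,
both from `[s, g)` and outside of `O`. -/
theorem exists_path_three (hE : IsMedianOrder E) {h s g : ℕ} (hs : h < s) (O : Finset ℕ)
    (hd : s + 6 * #{x ∈ Ico s g | x ∈ O} + (s - h - 1) + 5 ≤ g) :
    ∃ y ∈ Ico s g, ∃ z ∈ Ico s g, y ∉ O ∧ z ∉ O ∧ y ≠ z ∧ E h y ∧ E y z ∧ E z g := by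
  by_contra H
  push Not at H
  have hsg : s ≤ g := by omega
  let Y : Finset ℕ := {x ∈ Ico s g | x ∉ O ∧ E h x}
  let Z : Finset ℕ := {x ∈ Ico s g | x ∉ O ∧ E x g ∧ ¬ E h x}
  let W : Finset ℕ := {x ∈ Ico s g | x ∉ O ∧ E x g ∧ E h x}
  have hZ : ∀ z ∈ Z, z ∉ Y := by
    intro z hz hy
    simp only [Y, Z, mem_filter] at hz hy
    exact hz.2.2.2 hy.2.2
  have hZY : ∀ y ∈ Y, ∀ z ∈ Z, E z y := by
    intro y hy z hz
    have hne : y ≠ z := fun e => hZ z hz (e ▸ hy)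
    simp only [Y, Z, mem_filter] at hz hy
    rcases hE.total y z hne with h' | h'
    · exact absurd hz.2.2.1 (H y hy.1 z hz.1 hy.2.1 hz.2.1 hne hy.2.2 h')
    · exact h'
  have hW : #W ≤ 1 := by
    rw [card_le_one]
    intro a ha b hb
    by_contra hne
    simp only [W, mem_filter] at ha hb
    rcases hE.total a b hne with h' | h'
    · exact H a ha.1 b hb.1 ha.2.1 hb.2.1 hne ha.2.2.2 h' hb.2.2.1
    · exact H b hb.1 a ha.1 hb.2.1 ha.2.1 (Ne.symm hne) hb.2.2.2 h' ha.2.2.1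
  have hYs : Y ⊆ Ico s g := filter_subset _ _
  have hZs : Z ⊆ Ico s g := filter_subset _ _
  obtain ⟨v, hv, hYempty, hZR⟩ := hE.exists_cut hsg hYs hZs hZ hZY
  rw [mem_Icc] at hv
  -- the three classes partition `[v, g)`
  have hpart : #{x ∈ Y | v ≤ x} + #{x ∈ Z | v ≤ x} + #{x ∈ Ico s g \ (Y ∪ Z) | v ≤ x} ≤ g - v := by
    rw [← Nat.card_Ico, ← card_union_of_disjoint, ← card_union_of_disjoint]
    · apply card_le_card
      intro x hx
      rw [mem_Ico]
      rcases mem_union.1 hx with hx | hx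
      · rcases mem_union.1 hx with hx | hx
        · have := mem_Ico.1 (hYs (mem_filter.1 hx).1)
          have := (mem_filter.1 hx).2
          omega
        · have := mem_Ico.1 (hZs (mem_filter.1 hx).1)
          have := (mem_filter.1 hx).2
          omega
      · have := mem_Ico.1 (mem_sdiff.1 (mem_filter.1 hx).1).1
        have := (mem_filter.1 hx).2
        omega
    · rw [disjoint_left]
      intro x hx hx'
      simp only [mem_union, mem_filter, mem_sdiff] at hx hx'
      tauto
    · rw [disjoint_left]
      intro x hx hx'
      simp only [mem_filter] at hx hx'
      exact hZ x hx'.1 hx.1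
  have hO : #{x ∈ Ico s g | x ∈ O ∧ x < v} + #{x ∈ Ico s g | x ∈ O ∧ v ≤ x} =
      #{x ∈ Ico s g | x ∈ O} := by
    rw [← card_union_of_disjoint]
    · congr 1
      ext x
      simp only [mem_union, mem_filter]
      have := lt_or_ge x v
      tauto
    · rw [disjoint_filter]
      intro x _ h1 h2
      omega
  have hQ := hE.le_two_mul_card_in v g
  have hQ' : #{x ∈ Ico v g | E x g} ≤
      #{x ∈ Z | v ≤ x} + #W + #{x ∈ Ico s g | x ∈ O ∧ v ≤ x} := by
    refine (card_le_card ?_).trans ((card_union_le _ _).trans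
      (Nat.add_le_add_right (card_union_le _ _) _))
    intro x hx
    simp only [mem_union, mem_filter, Z, W, mem_Ico] at hx ⊢
    have : s ≤ x := by omega
    tauto
  have hP := hE.le_two_mul_card_out h g
  have hP' : #{x ∈ Ioo h g | E h x} ≤ (s - h - 1) + #{x ∈ Ico s g | x ∈ O ∧ x < v} +
      #{x ∈ Ico s g | x ∈ O ∧ v ≤ x} + #{x ∈ Y | v ≤ x} := by
    rw [← Nat.card_Ioo]
    refine (card_le_card ?_).trans ((card_union_le _ _).trans (Nat.add_le_add_right
      ((card_union_le _ _).trans (Nat.add_le_add_right (card_union_le _ _) _)) _))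
    intro x hx
    simp only [mem_union, mem_filter, mem_Ico, mem_Ioo] at hx ⊢
    by_cases h1 : x < s
    · left; left; left; omega
    · by_cases hxO : x ∈ O
      · left
        by_cases h2 : x < v
        · left; right; exact ⟨by omega, hxO, h2⟩
        · right; exact ⟨by omega, hxO, by omega⟩
      · right
        have hxY : x ∈ Y := by
          simp only [Y, mem_filter, mem_Ico]
          exact ⟨by omega, hxO, hx.2⟩
        exact ⟨hxY, hYempty x hxY⟩
  -- `hpart`, `hZR` and `hQ` leave at most `2` vertices in `Y` plus twice the obstacles behind `v`.
  -- Inserted into `hP`, this gives `g - s ≤ (s - h - 1) + 4 + 6 * #{x ∈ Ico s g | x ∈ O}`, against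
  -- `hd`.
  omega

end IsMedianOrder

/-! ### The greedy procedure for disjoint directed paths. -/

/-- The room that a path with `r + 2` interior vertices still to be embedded may need. -/
def pathWeight (r : ℕ) : ℕ := if r = 0 then 12 else r + 13

/-- For each `e` in `A`, `q e` lists the `r e + 2` interior vertices of a directed path from `h e` to
`g e`; the paths are disjoint, start behind `p` and avoid `O` and `U`. -/
structure IsPathSystem {ι : Type*} (E : ℕ → ℕ → Prop) (g : ι → ℕ) (U : Finset ℕ) (A : Finset ι)
    (h r : ι → ℕ) (O : Finset ℕ) (p : ℕ) (q : ι → ℕ → ℕ) : Prop where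
  first : ∀ e ∈ A, E (h e) (q e 0)
  step : ∀ e ∈ A, ∀ i < r e + 1, E (q e i) (q e (i + 1))
  last : ∀ e ∈ A, E (q e (r e + 1)) (g e)
  mem : ∀ e ∈ A, ∀ i < r e + 2, p ≤ q e i ∧ q e i < g e ∧ q e i ∉ O ∧ q e i ∉ U
  inj : ∀ e ∈ A, ∀ f ∈ A, ∀ i < r e + 2, ∀ j < r f + 2, q e i = q f j → e = f ∧ i = j

/-- A state of the greedy procedure that embeds disjoint directed paths into a median order. The paths
in `A` have reached the vertices `h e` before the position `p`, need `r e` more vertices, and end with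
a path of length three to `g e`. The vertices in `O` are reserved, those in `T` have been passed
because they were reserved or ended a path, and those in `S` have been skipped. -/
structure IsGreedyState {ι : Type*} (E : ℕ → ℕ → Prop) (g : ι → ℕ) (U : Finset ℕ) (B w : ℕ)
    (A : Finset ι) (h r : ι → ℕ) (O T S : Finset ℕ) (p : ℕ) : Prop where
  le_target : ∀ e ∈ A, B ≤ g e
  obstacles : ∀ e ∈ A, 6 * #{x ∈ U | x < g e} ≤ (g e - B) + w
  head_lt : ∀ e ∈ A, h e < p
  passed_lt : ∀ x ∈ T, x < p
  skipped_lt : ∀ x ∈ S, x < p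
  out_le : ∀ e ∈ A, 0 < r e → #{x ∈ Ioo (h e) p | E (h e) x} ≤
    #{f ∈ A | 0 < r f ∧ h e < h f} + #{x ∈ T | h e < x}
  skipped_le : ∀ q, #{x ∈ S | x < q} ≤ #{x ∈ T | x < q}
  skipped_adj : ∀ e ∈ A, ∀ x ∈ S, h e < x → E x (h e)
  head_near : ∀ e ∈ A, r e = 0 → p - h e - 1 + #S ≤ #T
  room : A.Nonempty →
    p + ∑ e ∈ A, pathWeight (r e) + 6 * #{x ∈ O | p ≤ x} + #T + w ≤ B + #S

namespace IsGreedyState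

variable {ι : Type*} {E : ℕ → ℕ → Prop} {g : ι → ℕ} {U : Finset ℕ} {B w : ℕ} {A : Finset ι}
  {h r : ι → ℕ} {O T S : Finset ℕ} {p : ℕ}

theorem card_skipped_le (H : IsGreedyState E g U B w A h r O T S p) : #S ≤ #T := by
  have := H.skipped_le p
  rwa [filter_true_of_mem H.skipped_lt, filter_true_of_mem H.passed_lt] at this

theorem weight_le (H : IsGreedyState E g U B w A h r O T S p) {e : ι} (he : e ∈ A) :
    p + pathWeight (r e) + 6 * #{x ∈ O | p ≤ x} + #T + w ≤ B + #S := by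
  have : pathWeight (r e) ≤ ∑ e ∈ A, pathWeight (r e) :=
    single_le_sum (f := fun e => pathWeight (r e)) (fun _ _ => Nat.zero_le _) he
  have := H.room ⟨e, he⟩
  omega

theorem lt_barrier (H : IsGreedyState E g U B w A h r O T S p) (hA : A.Nonempty) : p < B := by
  obtain ⟨e, he⟩ := hA
  have h1 := H.weight_le he
  have h2 : 12 ≤ pathWeight (r e) := by unfold pathWeight; split_ifs <;> omega
  have := H.card_skipped_le
  omega

theorem card_out_succ_le (a p : ℕ) (E : ℕ → ℕ → Prop) :
    #{x ∈ Ioo a (p + 1) | E a x} ≤ #{x ∈ Ioo a p | E a x} + if E a p then 1 else 0 := by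
  have : ({x ∈ Ioo a (p + 1) | E a x} : Finset ℕ) ⊆
      {x ∈ Ioo a p | E a x} ∪ (if E a p then {p} else ∅) := by
    intro x hx
    simp only [mem_filter, mem_Ioo, mem_union] at hx ⊢
    by_cases hxp : x = p
    · subst hxp
      right
      simp [hx.2]
    · left
      exact ⟨by omega, hx.2⟩
  refine (card_le_card this).trans ((card_union_le _ _).trans ?_)
  split_ifs <;> simp

theorem card_reserved_succ (O : Finset ℕ) (p : ℕ) :
    #{x ∈ O | p + 1 ≤ x} + (if p ∈ O then 1 else 0) ≤ #{x ∈ O | p ≤ x} := by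
  split_ifs with hp
  · refine card_lt_card (Finset.ssubset_iff_subset_ne.2 ⟨fun x hx => ?_, fun he => ?_⟩)
    · simp only [mem_filter] at hx ⊢
      exact ⟨hx.1, by omega⟩
    · have : p ∈ ({x ∈ O | p ≤ x} : Finset ℕ) := by simp [hp]
      rw [← he] at this
      simp at this
  · refine card_le_card fun x hx => ?_
    simp only [mem_filter] at hx ⊢
    exact ⟨hx.1, by omega⟩

/-- A reserved vertex is passed. -/
theorem pass (H : IsGreedyState E g U B w A h r O T S p) (hr : ∀ e ∈ A, 0 < r e) (hp : p ∈ O) :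
    IsGreedyState E g U B w A h r O (insert p T) S (p + 1) where
  le_target := H.le_target
  obstacles := H.obstacles
  head_lt e he := (H.head_lt e he).trans (Nat.lt_succ_self p)
  passed_lt x hx := by
    rcases mem_insert.1 hx with rfl | hx
    · exact Nat.lt_succ_self _
    · exact (H.passed_lt x hx).trans (Nat.lt_succ_self p)
  skipped_lt x hx := (H.skipped_lt x hx).trans (Nat.lt_succ_self p)
  out_le e he hre := by
    have h1 := H.out_le e he hre
    have h2 := card_out_succ_le (h e) p E
    have h3 : #{x ∈ insert p T | h e < x} = #{x ∈ T | h e < x} + 1 := by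
      rw [filter_insert, if_pos (H.head_lt e he), card_insert_of_notMem]
      exact fun hx => lt_irrefl _ (H.passed_lt p (mem_filter.1 hx).1)
    rw [h3]
    split_ifs at h2 <;> omega
  skipped_le q := (H.skipped_le q).trans
    (card_le_card (filter_subset_filter _ (subset_insert _ _)))
  skipped_adj := H.skipped_adj
  head_near e he h0 := absurd (hr e he) (by omega)
  room hA := by
    have h1 := H.room hA
    have h2 := card_reserved_succ O p
    rw [if_pos hp] at h2
    rw [card_insert_of_notMem fun hx => lt_irrefl _ (H.passed_lt p hx)]
    omega

/-- A vertex without an edge from a current end of a path is skipped. -/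
theorem skip (hE : IsMedianOrder E) (H : IsGreedyState E g U B w A h r O T S p)
    (hr : ∀ e ∈ A, 0 < r e) (hA : A.Nonempty) (hp : ∀ e ∈ A, ¬ E (h e) p) :
    IsGreedyState E g U B w A h r O T (insert p S) (p + 1) where
  le_target := H.le_target
  obstacles := H.obstacles
  head_lt e he := (H.head_lt e he).trans (Nat.lt_succ_self p)
  passed_lt x hx := (H.passed_lt x hx).trans (Nat.lt_succ_self p)
  skipped_lt x hx := by
    rcases mem_insert.1 hx with rfl | hx
    · exact Nat.lt_succ_self _
    · exact (H.skipped_lt x hx).trans (Nat.lt_succ_self p)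
  out_le e he hre := by
    have h1 := H.out_le e he hre
    have h2 := card_out_succ_le (h e) p E
    rw [if_neg (hp e he)] at h2
    omega
  skipped_le q := by
    by_cases hq : q ≤ p
    · rw [filter_insert, if_neg (by omega)]
      exact H.skipped_le q
    -- No current end lies behind the latest one, `h e`, so `T` alone accounts for the
    -- out-neighbours of `h e` up to `p`. All vertices skipped behind `h e`, and `p` itself, are
    -- in-neighbours of `h e`; the median order makes these at most as many.
    · obtain ⟨e, he, hmax⟩ := exists_max_image A h hA
      have h1 := H.out_le e he (hr e he)
      have h2 := card_out_succ_le (h e) p E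
      rw [if_neg (hp e he)] at h2
      have h3 := hE.card_in_le_card_out (h e) (p + 1)
      rw [filter_false_of_mem (s := A)] at h1
      swap
      · intro f hf hlt
        have := hmax f hf
        omega
      have h4 : #{x ∈ insert p S | h e < x} ≤ #{x ∈ Ioo (h e) (p + 1) | E x (h e)} := by
        refine card_le_card fun x hx => ?_
        simp only [mem_filter, mem_insert, mem_Ioo] at hx ⊢
        rcases hx.1 with rfl | hxS
        · refine ⟨by omega, ?_⟩
          rcases hE.total x (h e) (by omega) with h' | h'
          · exact h'
          · exact absurd h' (hp e he)
        · have := H.skipped_lt x hxS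
          exact ⟨by omega, H.skipped_adj e he x hxS hx.2⟩
      have h5 := H.skipped_le (h e + 1)
      have hsplit : ∀ C : Finset ℕ, #{x ∈ C | x < h e + 1} + #{x ∈ C | h e < x} = #C := by
        intro C
        rw [← card_filter_add_card_filter_not (s := C) (fun x => x < h e + 1)]
        congr 2
        apply filter_congr
        intro x _
        omega
      have h6 := hsplit T
      have h7 := hsplit (insert p S)
      have h8 : #{x ∈ insert p S | x < h e + 1} = #{x ∈ S | x < h e + 1} := by
        rw [filter_insert, if_neg]
        have := H.head_lt e he
        omega
      rw [filter_true_of_mem (s := T) fun x hx => (H.passed_lt x hx).trans (by omega)]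
      refine (card_filter_le _ _).trans ?_
      simp at h1
      omega
  skipped_adj e he x hx hlt := by
    rcases mem_insert.1 hx with rfl | hx
    · rcases hE.total x (h e) (by omega) with h' | h'
      · exact h'
      · exact absurd h' (hp e he)
    · exact H.skipped_adj e he x hx hlt
  head_near e he h0 := absurd (hr e he) (by omega)
  room hA := by
    have h1 := H.room hA
    have h2 := card_reserved_succ O p
    rw [card_insert_of_notMem fun hx => lt_irrefl _ (H.skipped_lt p hx)]
    omega

/-- The path with the earliest possible current end moves to `p`. -/
theorem move (H : IsGreedyState E g U B w A h r O T S p) (hr : ∀ e ∈ A, 0 < r e) {e : ι}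
    (he : e ∈ A) (hmin : ∀ f ∈ A, E (h f) p → h e ≤ h f) :
    IsGreedyState E g U B w A (Function.update h e p) (Function.update r e (r e - 1)) O
      (if r e = 1 then insert p T else T) S (p + 1) where
  le_target := H.le_target
  obstacles := H.obstacles
  head_lt f hf := by
    by_cases hfe : f = e
    · subst hfe; simp
    · rw [Function.update_of_ne hfe]
      exact (H.head_lt f hf).trans (Nat.lt_succ_self p)
  passed_lt x hx := by
    have : x = p ∨ x ∈ T := by
      split_ifs at hx
      · exact mem_insert.1 hx
      · exact Or.inr hx
    rcases this with rfl | hx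
    · exact Nat.lt_succ_self _
    · exact (H.passed_lt x hx).trans (Nat.lt_succ_self p)
  skipped_lt x hx := (H.skipped_lt x hx).trans (Nat.lt_succ_self p)
  out_le f hf hrf := by
    by_cases hfe : f = e
    · subst hfe
      rw [Function.update_self, filter_false_of_mem]
      · exact Nat.zero_le _
      · intro x hx
        rw [mem_Ioo] at hx
        omega
    · rw [Function.update_of_ne hfe]
      have h1 := H.out_le f hf (hr f hf)
      have h2 := card_out_succ_le (h f) p E
      have hfp := H.head_lt f hf
      set old : Finset ι := {f' ∈ A | 0 < r f' ∧ h f < h f'} with hold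
      set new : Finset ι := {f' ∈ A | 0 < Function.update r e (r e - 1) f' ∧
        h f < Function.update h e p f'} with hnew
      have hne : ∀ f' ∈ old, f' ≠ e → f' ∈ new := by
        intro f' hf' hne
        simp only [hold, hnew, mem_filter, Function.update_of_ne hne] at hf' ⊢
        exact hf'
      -- If `p` is a new out-neighbour of `h f`, then by the choice of `e` its old end was not
      -- behind `h f`. Moving it to `p` adds one to the right side for `f`, through `new` or, if `r
      -- e = 1`, through `T`.
      have hold' : E (h f) p → e ∉ old := by
        intro hEp hmem
        have := hmin f hf hEp
        have := (mem_filter.1 hmem).2.2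
        omega
      by_cases hre : r e = 1
      · have h3 : #{x ∈ (if r e = 1 then insert p T else T) | h f < x} =
            #{x ∈ T | h f < x} + 1 := by
          rw [if_pos hre, filter_insert, if_pos hfp, card_insert_of_notMem]
          exact fun hx => lt_irrefl _ (H.passed_lt p (mem_filter.1 hx).1)
        rw [h3]
        split_ifs at h2 with hEp
        · have : #old ≤ #new := card_le_card fun x hx =>
            hne x hx fun h => hold' hEp (h ▸ hx)
          omega
        · have : #old ≤ #(insert e new) := card_le_card fun x hx => by
            by_cases hxe : x = e
            · simp [hxe]
            · exact mem_insert_of_mem (hne x hx hxe)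
          have := card_insert_le e new
          omega
      · have hre' : 0 < r e - 1 := by
          have := hr e he
          omega
        rw [if_neg hre]
        have hmem : e ∈ new := by
          simp only [hnew, mem_filter, Function.update_self]
          exact ⟨he, hre', hfp⟩
        split_ifs at h2 with hEp
        · have h4 : #(insert e old) ≤ #new := card_le_card fun x hx => by
            rcases mem_insert.1 hx with rfl | hx
            · exact hmem
            · exact hne x hx fun h => hold' hEp (h ▸ hx)
          rw [card_insert_of_notMem (hold' hEp)] at h4
          omega
        · have : #old ≤ #new := card_le_card fun x hx => by
            by_cases hxe : x = e
            · exact hxe ▸ hmem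
            · exact hne x hx hxe
          omega
  skipped_le q := (H.skipped_le q).trans (card_le_card (filter_subset_filter _ (by
    split_ifs
    · exact subset_insert _ _
    · exact subset_rfl)))
  skipped_adj f hf x hx hlt := by
    by_cases hfe : f = e
    · subst hfe
      rw [Function.update_self] at hlt
      have := H.skipped_lt x hx
      omega
    · rw [Function.update_of_ne hfe] at hlt ⊢
      exact H.skipped_adj f hf x hx hlt
  head_near f hf h0 := by
    by_cases hfe : f = e
    · subst hfe
      rw [Function.update_self] at h0 ⊢
      have := H.card_skipped_le
      have := hr f hf
      rw [if_pos (by omega), card_insert_of_notMem fun hx => lt_irrefl _ (H.passed_lt p hx)]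
      omega
    · rw [Function.update_of_ne hfe] at h0
      exact absurd (hr f hf) (by omega)
  room hA := by
    have h1 := H.room hA
    have h2 := card_reserved_succ O p
    have h3 := hr e he
    rw [← add_sum_erase A _ he] at h1 ⊢
    have h4 : ∑ x ∈ A.erase e, pathWeight (Function.update r e (r e - 1) x) =
        ∑ x ∈ A.erase e, pathWeight (r x) :=
      sum_congr rfl fun x hx => by rw [Function.update_of_ne (ne_of_mem_erase hx)]
    rw [h4, Function.update_self]
    -- The last greedy step increases both `p` and `#T`, which costs `2 = 14 - 12`; an earlier one
    -- costs `1`.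
    by_cases hre : r e = 1
    · rw [if_pos hre, card_insert_of_notMem fun hx => lt_irrefl _ (H.passed_lt p hx)]
      have h5 : pathWeight (r e) = 14 := by rw [hre]; rfl
      have h6 : pathWeight (r e - 1) = 12 := by rw [hre]; rfl
      omega
    · rw [if_neg hre]
      have h5 : pathWeight (r e) = r e + 13 := by rw [pathWeight, if_neg (by omega)]
      have h6 : pathWeight (r e - 1) = r e - 1 + 13 := by rw [pathWeight, if_neg (by omega)]
      rw [h5] at h1
      rw [h6]
      omega

/-- A path is finished by a directed path of length three to its target. -/
theorem jump (hE : IsMedianOrder E) (H : IsGreedyState E g U B w A h r O T S p) {e : ι} (he : e ∈ A) (h0 : r e = 0) :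
    ∃ y z, p ≤ y ∧ y < g e ∧ y ∉ O ∧ y ∉ U ∧ p ≤ z ∧ z < g e ∧ z ∉ O ∧ z ∉ U ∧ y ≠ z ∧
      E (h e) y ∧ E y z ∧ E z (g e) ∧
      IsGreedyState E g U B w (A.erase e) h r (insert y (insert z O)) T S p := by
  have hw := H.weight_le he
  have hnear := H.head_near e he h0
  have htar := H.le_target e he
  have hobs := H.obstacles e he
  have hcard : #{x ∈ Ico p (g e) | x ∈ O ∪ U} ≤ #{x ∈ O | p ≤ x} + #{x ∈ U | x < g e} := by
    refine (card_le_card fun x hx => ?_).trans (card_union_le _ _)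
    simp only [mem_filter, mem_Ico, mem_union] at hx ⊢
    tauto
  have hw0 : pathWeight (r e) = 12 := by simp [pathWeight, h0]
  rw [hw0] at hw
  -- The gap `p - h e - 1` is at most `#T - #S` by `head_near`, and the obstacles in `U` cost at
  -- most `(g e - B) + w`; `room` has set aside the terms other than `g e - B`, which the distance
  -- from `B` to the target provides.
  obtain ⟨y, hy, z, hz, hyO, hzO, hyz, h1, h2, h3⟩ :=
    hE.exists_path_three (H.head_lt e he) (g := g e) (O ∪ U) (by omega)
  rw [mem_Ico] at hy hz
  rw [mem_union, not_or] at hyO hzO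
  refine ⟨y, z, hy.1, hy.2, hyO.1, hyO.2, hz.1, hz.2, hzO.1, hzO.2, hyz, h1, h2, h3, ?_⟩
  refine ⟨fun f hf => H.le_target f (mem_of_mem_erase hf),
    fun f hf => H.obstacles f (mem_of_mem_erase hf),
    fun f hf => H.head_lt f (mem_of_mem_erase hf), H.passed_lt, H.skipped_lt,
    fun f hf hrf => ?_, H.skipped_le,
    fun f hf => H.skipped_adj f (mem_of_mem_erase hf),
    fun f hf => H.head_near f (mem_of_mem_erase hf), fun _ => ?_⟩
  · refine (H.out_le f (mem_of_mem_erase hf) hrf).trans (Nat.add_le_add_right (card_le_card ?_) _)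
    intro f' hf'
    simp only [mem_filter, mem_erase] at hf' ⊢
    refine ⟨⟨fun hfe => ?_, hf'.1⟩, hf'.2⟩
    rw [hfe, h0] at hf'
    exact lt_irrefl _ hf'.2.1
  · have h4 := H.room ⟨e, he⟩
    rw [← add_sum_erase A _ he, hw0] at h4
    -- Two new reserved vertices at cost `6` each use up the weight `12` of the finished path.
    have h5 : #{x ∈ insert y (insert z O) | p ≤ x} ≤ #{x ∈ O | p ≤ x} + 2 := by
      rw [filter_insert, if_pos hy.1, filter_insert, if_pos hz.1]
      refine (card_insert_le _ _).trans ?_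
      have := card_insert_le z ({x ∈ O | p ≤ x} : Finset ℕ)
      omega
    omega

end IsGreedyState

/-- The greedy procedure embeds all paths. -/
theorem IsMedianOrder.exists_isPathSystem {ι : Type*} {E : ℕ → ℕ → Prop} (hE : IsMedianOrder E)
    {g : ι → ℕ} {U : Finset ℕ} {B w : ℕ} (hU : ∀ x ∈ U, B ≤ x) {A : Finset ι} {h r : ι → ℕ}
    {O T S : Finset ℕ} {p : ℕ} (H : IsGreedyState E g U B w A h r O T S p) :
    ∃ q, IsPathSystem E g U A h r O p q := by
  -- A finished path leaves `A`, and every other step advances `p`, which stays below `B` while `A`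
  -- is nonempty.
  induction hm : (B - p) + #A using Nat.strong_induction_on generalizing A h r O T S p with
  | _ m ih =>
  rcases A.eq_empty_or_nonempty with rfl | hA
  · exact ⟨fun _ _ => 0, by constructor <;> simp⟩
  have hpB := H.lt_barrier hA
  by_cases h0 : ∃ e ∈ A, r e = 0
  · obtain ⟨e, he, h0⟩ := h0
    obtain ⟨y, z, hy, hyg, hyO, hyU, hz, hzg, hzO, hzU, hyz, h1, h2, h3, H'⟩ := H.jump hE he h0
    have hlt := card_erase_lt_of_mem he
    obtain ⟨q, hq⟩ := ih _ (by omega) H' rfl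
    have hne : ∀ f ∈ A, f ≠ e → f ∈ A.erase e := fun f hf hfe => mem_erase.2 ⟨hfe, hf⟩
    have hsmall : ∀ i < r e + 2, i = 0 ∨ i = 1 := by intro i hi; omega
    refine ⟨Function.update q e fun i => if i = 0 then y else z, ?_, ?_, ?_, ?_, ?_⟩
    · intro f hf
      by_cases hfe : f = e
      · subst hfe; simpa using h1
      · rw [Function.update_of_ne hfe]
        exact hq.first f (hne f hf hfe)
    · intro f hf i hi
      by_cases hfe : f = e
      · subst hfe
        obtain rfl : i = 0 := by omega
        simpa using h2
      · rw [Function.update_of_ne hfe]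
        exact hq.step f (hne f hf hfe) i hi
    · intro f hf
      by_cases hfe : f = e
      · subst hfe; simpa using h3
      · rw [Function.update_of_ne hfe]
        exact hq.last f (hne f hf hfe)
    · intro f hf i hi
      by_cases hfe : f = e
      · subst hfe
        rcases hsmall i hi with rfl | rfl
        · simpa using ⟨hy, hyg, hyO, hyU⟩
        · simpa using ⟨hz, hzg, hzO, hzU⟩
      · rw [Function.update_of_ne hfe]
        have := hq.mem f (hne f hf hfe) i hi
        simp only [mem_insert, not_or] at this
        tauto
    · have key : ∀ f ∈ A, f ≠ e → ∀ i < r f + 2, q f i ≠ y ∧ q f i ≠ z := by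
        intro f hf hfe i hi
        have := (hq.mem f (hne f hf hfe) i hi).2.2.1
        simp only [mem_insert, not_or] at this
        tauto
      intro f hf f' hf' i hi j hj hij
      by_cases hfe : f = e <;> by_cases hfe' : f' = e
      · subst hfe hfe'
        rw [Function.update_self] at hij
        refine ⟨rfl, ?_⟩
        rcases hsmall i hi with rfl | rfl <;> rcases hsmall j hj with rfl | rfl
        · rfl
        · simp [hyz] at hij
        · simp [hyz.symm] at hij
        · rfl
      · subst hfe
        rw [Function.update_self, Function.update_of_ne hfe'] at hij
        have := key f' hf' hfe' j hj
        split_ifs at hij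
        · exact absurd hij.symm this.1
        · exact absurd hij.symm this.2
      · subst hfe'
        rw [Function.update_self, Function.update_of_ne hfe] at hij
        have := key f hf hfe i hi
        split_ifs at hij
        · exact absurd hij this.1
        · exact absurd hij this.2
      · rw [Function.update_of_ne hfe, Function.update_of_ne hfe'] at hij
        exact hq.inj f (hne f hf hfe) f' (hne f' hf' hfe') i hi j hj hij
  · have hr : ∀ e ∈ A, 0 < r e := fun e he => Nat.pos_of_ne_zero fun h => h0 ⟨e, he, h⟩
    have weaken : ∀ {q}, IsPathSystem E g U A h r O (p + 1) q → IsPathSystem E g U A h r O p q :=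
      fun {q} hq => ⟨hq.first, hq.step, hq.last, fun e he i hi => by
        have := hq.mem e he i hi
        exact ⟨by omega, this.2⟩, hq.inj⟩
    by_cases hpO : p ∈ O
    · obtain ⟨q, hq⟩ := ih _ (by omega) (H.pass hr hpO) rfl
      exact ⟨q, weaken hq⟩
    by_cases hout : ∃ e ∈ A, E (h e) p
    · obtain ⟨e, he, hmin⟩ := exists_min_image {e ∈ A | E (h e) p} h (by
        obtain ⟨e, he⟩ := hout
        exact ⟨e, mem_filter.2 he⟩)
      rw [mem_filter] at he
      obtain ⟨q, hq⟩ := ih _ (by omega) (H.move hr he.1 fun f hf hEf =>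
        hmin f (mem_filter.2 ⟨hf, hEf⟩)) rfl
      have hre := hr e he.1
      have hlen : Function.update r e (r e - 1) e = r e - 1 := Function.update_self ..
      have hlen' : ∀ f, f ≠ e → Function.update r e (r e - 1) f = r f :=
        fun f hf => Function.update_of_ne hf ..
      have hhead : Function.update h e p e = p := Function.update_self ..
      refine ⟨Function.update q e fun i => if i = 0 then p else q e (i - 1), ?_, ?_, ?_, ?_, ?_⟩
      · intro f hf
        by_cases hfe : f = e
        · subst hfe; simpa using he.2
        · rw [Function.update_of_ne hfe]
          have := hq.first f hf
          rwa [Function.update_of_ne hfe] at this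
      · intro f hf i hi
        by_cases hfe : f = e
        · subst hfe
          rw [Function.update_self]
          rcases Nat.eq_zero_or_pos i with rfl | hi0
          · have := hq.first f hf
            rw [hhead] at this
            simpa using this
          · have := hq.step f hf (i - 1) (by omega)
            rw [Nat.sub_add_cancel hi0] at this
            rw [if_neg (by omega), if_neg (by omega)]
            exact this
        · rw [Function.update_of_ne hfe]
          exact hq.step f hf i (by rw [hlen' f hfe]; exact hi)
      · intro f hf
        have := hq.last f hf
        by_cases hfe : f = e
        · subst hfe
          rw [hlen, Nat.sub_add_cancel hre] at this
          simpa using this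
        · rw [hlen' f hfe] at this
          rwa [Function.update_of_ne hfe]
      · intro f hf i hi
        by_cases hfe : f = e
        · subst hfe
          rw [Function.update_self]
          have htar := H.le_target f hf
          by_cases hi0 : i = 0
          · rw [if_pos hi0]
            refine ⟨le_rfl, by omega, hpO, fun hpU => ?_⟩
            have := hU p hpU
            omega
          · rw [if_neg hi0]
            have := hq.mem f hf (i - 1) (by omega)
            exact ⟨by omega, this.2⟩
        · rw [Function.update_of_ne hfe]
          have := hq.mem f hf i (by rw [hlen' f hfe]; exact hi)
          exact ⟨by omega, this.2⟩
      · have key : ∀ f ∈ A, ∀ i < Function.update r e (r e - 1) f + 2, p < q f i :=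
          fun f hf i hi => (hq.mem f hf i hi).1
        intro f hf f' hf' i hi j hj hij
        by_cases hfe : f = e <;> by_cases hfe' : f' = e
        · subst hfe hfe'
          rw [Function.update_self] at hij
          refine ⟨rfl, ?_⟩
          split_ifs at hij with h1 h2 h2
          · omega
          · have := key f' hf (j - 1) (by omega)
            omega
          · have := key f' hf (i - 1) (by omega)
            omega
          · have := (hq.inj f' hf f' hf _ (by omega) _ (by omega) hij).2
            omega
        · subst hfe
          rw [Function.update_self, Function.update_of_ne hfe'] at hij
          have hj' : j < Function.update r f (r f - 1) f' + 2 := by rw [hlen' f' hfe']; exact hj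
          have h1 := key f' hf' j hj'
          split_ifs at hij
          · omega
          · exact absurd (hq.inj f hf f' hf' _ (by omega) _ hj' hij).1.symm hfe'
        · subst hfe'
          rw [Function.update_self, Function.update_of_ne hfe] at hij
          have hi' : i < Function.update r f' (r f' - 1) f + 2 := by rw [hlen' f hfe]; exact hi
          have h1 := key f hf i hi'
          split_ifs at hij
          · omega
          · exact absurd (hq.inj f hf f' hf' _ hi' _ (by omega) hij).1 hfe
        · rw [Function.update_of_ne hfe, Function.update_of_ne hfe'] at hij
          exact hq.inj f hf f' hf' i (by rw [hlen' f hfe]; exact hi) j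
            (by rw [hlen' f' hfe']; exact hj) hij
    · push Not at hout
      obtain ⟨q, hq⟩ := ih _ (by omega) (H.skip hE hr hA hout) rfl
      exact ⟨q, weaken hq⟩

/-! ### Sparse embeddings of forests, and paths between blocks. -/

/-- `par` and `d` describe a rooted forest containing all edges of `Adj`: of any two adjacent vertices,
one is the parent of the other, and `d` is the depth. -/
def IsRootedBy {V : Type*} (Adj : V → V → Prop) (par : V → V) (d : V → ℕ) : Prop :=
  ∀ u v, Adj u v → (par v = u ∧ d v = d u + 1) ∨ (par u = v ∧ d u = d v + 1)

namespace IsMedianOrder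

variable {V : Type*} {E : ℕ → ℕ → Prop} {Adj : V → V → Prop} {par : V → V} {d : V → ℕ}

/-- A forest on `m` vertices embeds in each interval of length `4 m`, in such a way that at most about
half of each initial and of each final part of the interval is used. -/
theorem exists_sparse_embedding (hE : IsMedianOrder E) (hpar : IsRootedBy Adj par d)
    (hor : ∀ u v, Adj u v → ¬ Adj v u) (S : Finset V) (B : ℕ) :
    ∃ f : V → ℕ, Set.InjOn f S ∧ (∀ x ∈ S, B ≤ f x ∧ f x < B + 4 * #S) ∧
      (∀ u ∈ S, ∀ v ∈ S, Adj u v → E (f u) (f v)) ∧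
      (∀ q, B ≤ q → q ≤ B + 4 * #S → 2 * #{x ∈ S | f x < q} ≤ q - B + 1) ∧
      (∀ q, B ≤ q → q ≤ B + 4 * #S → 2 * #{x ∈ S | q ≤ f x} ≤ B + 4 * #S - q + 1) := by
  induction hm : #S generalizing S B with
  | zero =>
    rw [card_eq_zero] at hm
    subst hm
    exact ⟨fun _ => 0, by simp⟩
  | succ m ih =>
    obtain ⟨x, hx, hmax⟩ := exists_max_image S d (card_pos.1 (by omega))
    have hm' : #(S.erase x) = m := by rw [card_erase_of_mem hx, hm]; rfl
    -- The deepest vertex `x` can only be adjacent to its parent within `S`. The margins of two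
    -- positions on both sides give the parent more suitable neighbours than there are used
    -- positions, and they pay for `x` in the density bounds.
    obtain ⟨f, hinj, hmem, hadj, hpre, hsuf⟩ := ih (S.erase x) (B + 2) hm'
    obtain ⟨j, hjB, hjN, hjf, hj1, hj2⟩ : ∃ j, B ≤ j ∧ j < B + 4 * (m + 1) ∧
        (∀ y ∈ S.erase x, f y ≠ j) ∧
        (par x ∈ S.erase x → Adj (par x) x → E (f (par x)) j) ∧
        (par x ∈ S.erase x → Adj x (par x) → E j (f (par x))) := by
      by_cases hp : par x ∈ S.erase x
      · have hpm := hmem _ hp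
        by_cases h1 : Adj (par x) x
        · have hout := hE.le_two_mul_card_out (f (par x)) (B + 4 * (m + 1))
          have hused := hsuf (f (par x) + 1) (by omega) (by omega)
          obtain ⟨j, hj, hjn⟩ := exists_mem_notMem_of_card_lt_card
            (s := ({y ∈ S.erase x | f (par x) + 1 ≤ f y} : Finset V).image f)
            (t := ({j ∈ Ioo (f (par x)) (B + 4 * (m + 1)) | E (f (par x)) j} : Finset ℕ))
            (lt_of_le_of_lt card_image_le (by omega))
          simp only [mem_filter, mem_Ioo] at hj
          refine ⟨j, by omega, by omega, fun y hy hyj => hjn ?_, fun _ _ => hj.2,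
            fun _ h2 => absurd h2 (hor _ _ h1)⟩
          rw [mem_image]
          exact ⟨y, mem_filter.2 ⟨hy, by omega⟩, hyj⟩
        · have hin := hE.le_two_mul_card_in B (f (par x))
          have hused := hpre (f (par x)) (by omega) (by omega)
          obtain ⟨j, hj, hjn⟩ := exists_mem_notMem_of_card_lt_card
            (s := ({y ∈ S.erase x | f y < f (par x)} : Finset V).image f)
            (t := ({j ∈ Ico B (f (par x)) | E j (f (par x))} : Finset ℕ))
            (lt_of_le_of_lt card_image_le (by omega))
          simp only [mem_filter, mem_Ico] at hj
          refine ⟨j, by omega, by omega, fun y hy hyj => hjn ?_, fun _ h2 => absurd h2 h1,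
            fun _ _ => hj.2⟩
          rw [mem_image]
          exact ⟨y, mem_filter.2 ⟨hy, by omega⟩, hyj⟩
      · refine ⟨B, le_rfl, by omega, fun y hy hyj => ?_, fun h => absurd h hp,
          fun h => absurd h hp⟩
        have := hmem y hy
        omega
    have hne : ∀ y ∈ S, y ≠ x → y ∈ S.erase x := fun y hy h => mem_erase.2 ⟨h, hy⟩
    have hmono : ∀ (P : ℕ → Prop) [DecidablePred P], #{y ∈ S | P (Function.update f x j y)} ≤
        #{y ∈ S.erase x | P (f y)} + if P j then 1 else 0 := by
      intro P _
      have hsub : ({y ∈ S | P (Function.update f x j y)} : Finset V) ⊆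
          {y ∈ S.erase x | P (f y)} ∪ if P j then {x} else ∅ := by
        intro y hy
        rw [mem_filter] at hy
        rw [mem_union, mem_filter]
        by_cases hyx : y = x
        · subst hyx
          rw [Function.update_self] at hy
          right
          simp [hy.2]
        · rw [Function.update_of_ne hyx] at hy
          exact Or.inl ⟨hne y hy.1 hyx, hy.2⟩
      refine (card_le_card hsub).trans ((card_union_le _ _).trans (Nat.add_le_add_left ?_ _))
      split_ifs <;> simp
    refine ⟨Function.update f x j, ?_, ?_, ?_, ?_, ?_⟩
    · intro a ha b hb hab
      by_cases hax : a = x <;> by_cases hbx : b = x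
      · rw [hax, hbx]
      · rw [hax, Function.update_self, Function.update_of_ne hbx] at hab
        exact absurd hab.symm (hjf b (hne b hb hbx))
      · rw [hbx, Function.update_self, Function.update_of_ne hax] at hab
        exact absurd hab (hjf a (hne a ha hax))
      · rw [Function.update_of_ne hax, Function.update_of_ne hbx] at hab
        exact hinj (hne a ha hax) (hne b hb hbx) hab
    · intro y hy
      by_cases hyx : y = x
      · rw [hyx, Function.update_self]
        exact ⟨hjB, hjN⟩
      · rw [Function.update_of_ne hyx]
        have := hmem y (hne y hy hyx)
        omega
    · intro u hu v hv huv
      have hpuv := hpar u v huv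
      by_cases hux : u = x
      · have hvx : v ≠ x := by rintro rfl; subst hux; omega
        subst hux
        rw [Function.update_self, Function.update_of_ne hvx]
        rcases hpuv with h | h
        · have := hmax v hv
          omega
        · have h' := h.1
          subst h'
          exact hj2 (hne _ hv hvx) huv
      · by_cases hvx : v = x
        · subst hvx
          rw [Function.update_self, Function.update_of_ne hux]
          rcases hpuv with h | h
          · have h' := h.1
            subst h'
            exact hj1 (hne _ hu hux) huv
          · have := hmax u hu
            omega
        · rw [Function.update_of_ne hux, Function.update_of_ne hvx]
          exact hadj u (hne u hu hux) v (hne v hv hvx) huv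
    · intro q hq hqN
      have h1 : #{y ∈ S | Function.update f x j y < q} ≤
          #{y ∈ S.erase x | f y < q} + if j < q then 1 else 0 := hmono (· < q)
      have h2 : #{y ∈ S.erase x | f y < q} ≤ m := hm' ▸ card_filter_le _ _
      rcases lt_or_ge q (B + 2) with h3 | h3
      · have h4 : #{y ∈ S.erase x | f y < q} = 0 := by
          rw [card_eq_zero, filter_eq_empty_iff]
          intro y hy
          have := hmem y hy
          omega
        split_ifs at h1 <;> omega
      · rcases le_or_gt q (B + 2 + 4 * m) with h4 | h4
        · have := hpre q h3 h4
          split_ifs at h1 <;> omega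
        · split_ifs at h1 <;> omega
    · intro q hq hqN
      have h1 : #{y ∈ S | q ≤ Function.update f x j y} ≤
          #{y ∈ S.erase x | q ≤ f y} + if q ≤ j then 1 else 0 := hmono (q ≤ ·)
      have h2 : #{y ∈ S.erase x | q ≤ f y} ≤ m := hm' ▸ card_filter_le _ _
      rcases lt_or_ge q (B + 2) with h3 | h3
      · split_ifs at h1 <;> omega
      · rcases le_or_gt q (B + 2 + 4 * m) with h4 | h4
        · have := hsuf q h3 h4
          split_ifs at h1 <;> omega
        · have h4 : #{y ∈ S.erase x | q ≤ f y} = 0 := by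
            rw [card_eq_zero, filter_eq_empty_iff]
            intro y hy
            have := hmem y hy
            omega
          split_ifs at h1 <;> omega

/-- The last bound is what `IsGreedyState.obstacles` asks of a target block, with `w = 4 * #S`. For
`c` vertices before `f x`, write `6 * c = 2 * c + 4 * c` and use sparsity for the first term and `c
< #S` for the second. -/
theorem exists_forest_embedding (hE : IsMedianOrder E) (hpar : IsRootedBy Adj par d)
    (hor : ∀ u v, Adj u v → ¬ Adj v u) (S : Finset V) (B : ℕ) :
    ∃ f : V → ℕ, Set.InjOn f S ∧ (∀ x ∈ S, B ≤ f x ∧ f x < B + 4 * #S) ∧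
      (∀ u ∈ S, ∀ v ∈ S, Adj u v → E (f u) (f v)) ∧
      ∀ x ∈ S, 6 * #{y ∈ S.image f | y < f x} ≤ (f x - B) + 4 * #S := by
  obtain ⟨f, hinj, hmem, hadj, hpre, -⟩ := hE.exists_sparse_embedding hpar hor S B
  refine ⟨f, hinj, hmem, hadj, fun x hx => ?_⟩
  have h1 := hmem x hx
  have h2 := hpre (f x) (by omega) (by omega)
  have h3 : #{y ∈ S | f y < f x} < #S := card_lt_card (filter_ssubset.2 ⟨x, hx, by omega⟩)
  have h4 : #{y ∈ S.image f | y < f x} ≤ #{y ∈ S | f y < f x} := by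
    rw [filter_image]
    exact card_image_le
  omega

/-- Disjoint directed paths between two intervals with given ends. -/
theorem exists_paths_between {ι : Type*} (hE : IsMedianOrder E) {A : Finset ι} {h g r : ι → ℕ}
    {U : Finset ℕ} {a p b w : ℕ} (hh : ∀ e ∈ A, a ≤ h e ∧ h e < p) (hU : ∀ x ∈ U, b ≤ x)
    (hg : ∀ e ∈ A, b ≤ g e ∧ 6 * #{x ∈ U | x < g e} ≤ (g e - b) + w)
    (hroom : p + ∑ e ∈ A, (r e + 13) + (p - a) + w ≤ b) :
    ∃ q, IsPathSystem E g U A h r ∅ p q := by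
  -- Declaring the whole starting block passed makes `out_le` and `head_near` immediate, at the cost
  -- `p - a`.
  refine hE.exists_isPathSystem (B := b) (w := w) (T := Ico a p) (S := ∅) hU ⟨fun e he => (hg e he).1,
    fun e he => (hg e he).2, fun e he => (hh e he).2, fun x hx => (mem_Ico.1 hx).2, by simp,
    fun e he _ => ?_, by simp, by simp, fun e he _ => ?_, fun _ => ?_⟩
  · refine le_trans (card_le_card fun x hx => ?_) (Nat.le_add_left _ _)
    have := hh e he
    simp only [mem_filter, mem_Ioo, mem_Ico] at hx ⊢
    omega
  · have := hh e he
    simp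
    omega
  · have : ∑ e ∈ A, pathWeight (r e) ≤ ∑ e ∈ A, (r e + 13) :=
      sum_le_sum fun e _ => by unfold pathWeight; split_ifs <;> omega
    simp
    omega

end IsMedianOrder

/-! ### Rooted trees, potentials and the number of edges. -/

theorem SimpleGraph.IsTree.exists_isRootedBy {V : Type*} {G : SimpleGraph V} (hG : G.IsTree) :
    ∃ (par : V → V) (d : V → ℕ), IsRootedBy G.Adj par d ∧ ∃ root, d root = 0 := by
  obtain ⟨root⟩ := hG.connected.nonempty
  choose p hp _ using fun v => hG.existsUnique_path root v
  have key : ∀ u v, G.Adj u v → u ∈ (p v).support →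
      u = (p v).penultimate ∧ (p v).length = (p u).length + 1 := by
    intro u v huv hu
    refine ⟨hG.isAcyclic.eq_penultimate_of_adj_end (hp v) huv.symm hu, ?_⟩
    rw [hG.isAcyclic.path_concat (hp u) (hp v) huv hu, SimpleGraph.Walk.length_concat]
  refine ⟨fun v => (p v).penultimate, fun v => (p v).length, fun u v huv => ?_, root, ?_⟩
  · by_cases hu : u ∈ (p v).support
    · have := key u v huv hu
      exact Or.inl ⟨this.1.symm, this.2⟩
    · have hv := hG.isAcyclic.mem_support_of_ne_mem_support_of_adj_of_isPath (hp u) (hp v) huv hu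
      have := key v u huv.symm hv
      exact Or.inr ⟨this.1.symm, this.2⟩
  · exact SimpleGraph.Walk.length_eq_zero_iff.2 (SimpleGraph.Walk.isPath_iff_nil.1 (hp root))

namespace IsRootedBy

variable {V : Type*} {Adj : V → V → Prop} {par : V → V} {d : V → ℕ}

/-- Among the vertices of at most its own depth, a vertex can be adjacent only to its parent, so its
value can be chosen freely from that of the parent. -/
theorem exists_potential_le (hpar : IsRootedBy Adj par d) (hor : ∀ u v, Adj u v → ¬ Adj v u)
    (wt : V → V → ℤ) (n : ℕ) :
    ∃ lv : V → ℤ, ∀ u v, d u ≤ n → d v ≤ n → Adj u v → lv v = lv u + wt u v := by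
  induction n with
  | zero =>
    refine ⟨fun _ => 0, fun u v hu hv huv => ?_⟩
    have := hpar u v huv
    omega
  | succ n ih =>
    obtain ⟨lv, hlv⟩ := ih
    refine ⟨fun x => if d x = n + 1 then
      (if Adj (par x) x then lv (par x) + wt (par x) x else lv (par x) - wt x (par x)) else lv x,
      fun u v hu hv huv => ?_⟩
    beta_reduce
    rcases hpar u v huv with ⟨rfl, hd⟩ | ⟨rfl, hd⟩
    · by_cases h : d v = n + 1
      · rw [if_pos h, if_pos huv, if_neg (by omega)]
      · rw [if_neg h, if_neg (by omega)]
        exact hlv _ _ (by omega) (by omega) huv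
    · by_cases h : d u = n + 1
      · rw [if_neg (by omega), if_pos h, if_neg (hor _ _ huv)]
        ring
      · rw [if_neg (by omega), if_neg h]
        exact hlv _ _ (by omega) (by omega) huv

/-- Prescribed differences along the edges of a finite forest come from a function on its vertices. -/
theorem exists_potential [Finite V] [Nonempty V] (hpar : IsRootedBy Adj par d)
    (hor : ∀ u v, Adj u v → ¬ Adj v u) (wt : V → V → ℕ) :
    ∃ lv : V → ℕ, ∀ u v, Adj u v → lv v = lv u + wt u v := by
  obtain ⟨m, hm⟩ := Finite.exists_max d
  obtain ⟨lv, hlv⟩ := hpar.exists_potential_le hor (fun u v => (wt u v : ℤ)) (d m)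
  obtain ⟨b, hb⟩ := Finite.exists_min lv
  refine ⟨fun v => (lv v - lv b).toNat, fun u v huv => ?_⟩
  have h1 := hlv u v (hm u) (hm v) huv
  have h2 := hb u
  have h3 := hb v
  simp only
  omega

/-- Assigning to each edge its deeper end is injective and misses the root. -/
theorem card_edges_lt [Fintype V] (hpar : IsRootedBy Adj par d) (hor : ∀ u v, Adj u v → ¬ Adj v u)
    (hroot : ∃ root, d root = 0) :
    #{z : V × V | Adj z.1 z.2} < Fintype.card V := by
  obtain ⟨root, hroot⟩ := hroot
  rw [← card_univ]
  refine lt_of_le_of_lt (card_le_card_of_injOn (t := univ.erase root)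
    (fun z => if d z.1 < d z.2 then z.2 else z.1) ?_ ?_) (card_erase_lt_of_mem (mem_univ root))
  · rintro ⟨u, v⟩ hz
    simp only [coe_filter, mem_univ, true_and, Set.mem_ofPred_eq] at hz
    simp only [coe_erase, coe_univ, Set.mem_sdiff, Set.mem_univ, true_and, Set.mem_singleton_iff]
    have := hpar u v hz
    intro h
    split_ifs at h with h1
    · subst h; omega
    · subst h; omega
  · rintro ⟨u, v⟩ hz ⟨u', v'⟩ hz' h
    simp only [coe_filter, mem_univ, true_and, Set.mem_ofPred_eq] at hz hz'
    simp only at h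
    rcases hpar u v hz with ⟨h1, h2⟩ | ⟨h1, h2⟩ <;> rcases hpar u' v' hz' with ⟨h3, h4⟩ | ⟨h3, h4⟩
    · rw [if_pos (by omega), if_pos (by omega)] at h
      subst h
      rw [← h1, ← h3]
    · rw [if_pos (by omega), if_neg (by omega)] at h
      subst h
      rw [h1] at h3
      subst h3
      exact absurd hz' (hor _ _ hz)
    · rw [if_neg (by omega), if_pos (by omega)] at h
      subst h
      rw [h1] at h3
      subst h3
      exact absurd hz' (hor _ _ hz)
    · rw [if_neg (by omega), if_neg (by omega)] at h
      subst h
      rw [← h1, ← h3]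

end IsRootedBy

/-! ### Decomposition into runs. -/

/-- The decomposition of a set `L` into maximal runs `x, succ x, succ (succ x), …`: the run of `x`
starts at `st x`, has `len (st x)` elements, `x` is at index `ix x`, and the run ends at
`last (st x)`. -/
structure IsRunDecomposition {V : Type*} (L : Finset V) (pred succ st : V → V) (ix len : V → ℕ)
    (last : V → V) : Prop where
  start_mem : ∀ x ∈ L, st x ∈ L ∧ pred (st x) ∉ L
  of_start : ∀ x ∈ L, pred x ∉ L → st x = x ∧ ix x = 0
  of_pred : ∀ x ∈ L, pred x ∈ L → st x = st (pred x) ∧ ix x = ix (pred x) + 1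
  ix_lt : ∀ x ∈ L, ix x < len (st x)
  ix_inj : ∀ x ∈ L, ∀ y ∈ L, st x = st y → ix x = ix y → x = y
  of_succ : ∀ x ∈ L, succ x ∉ L → ix x + 1 = len (st x) ∧ last (st x) = x
  last_mem : ∀ s ∈ L, pred s ∉ L → last s ∈ L ∧ succ (last s) ∉ L ∧ st (last s) = s
  len_eq : ∀ s, len s = #{x ∈ L | st x = s}

/-- The height `H` makes recursion along `pred` terminate and gives the index `H x - H (st x)`. -/
theorem exists_isRunDecomposition {V : Type*} {L : Finset V} {pred succ : V → V} {H : V → ℕ}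
    (hH : ∀ x ∈ L, H x = H (pred x) + 1) (hsp : ∀ x ∈ L, pred x ∈ L → succ (pred x) = x)
    (hps : ∀ x ∈ L, succ x ∈ L → pred (succ x) = x) :
    ∃ st ix len last, IsRunDecomposition L pred succ st ix len last := by
  have hst : ∀ n : ℕ, ∃ st : V → V, ∀ x ∈ L, H x ≤ n →
      (pred x ∉ L → st x = x) ∧ (pred x ∈ L → st x = st (pred x)) := by
    intro n
    induction n with
    | zero => exact ⟨id, fun x hx h => by have := hH x hx; omega⟩
    | succ n ih =>
      obtain ⟨st, hst⟩ := ih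
      refine ⟨fun x => if H x ≤ n then st x else if pred x ∈ L then st (pred x) else x,
        fun x hx h => ?_⟩
      have h1 := hH x hx
      have h2 : H (pred x) ≤ n := by omega
      simp only [if_pos h2]
      by_cases h3 : H x ≤ n
      · simp only [if_pos h3]
        exact hst x hx h3
      · simp only [if_neg h3]
        exact ⟨fun h => if_neg h, fun h => if_pos h⟩
  obtain ⟨n, hn⟩ : ∃ n, ∀ x ∈ L, H x ≤ n := ⟨L.sup H, fun x hx => le_sup hx⟩
  obtain ⟨st, hst⟩ := hst n
  have hst0 : ∀ x ∈ L, pred x ∉ L → st x = x := fun x hx => (hst x hx (hn x hx)).1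
  have hst1 : ∀ x ∈ L, pred x ∈ L → st x = st (pred x) := fun x hx => (hst x hx (hn x hx)).2
  have hind : ∀ P : V → Prop, (∀ x ∈ L, pred x ∉ L → P x) →
      (∀ x ∈ L, pred x ∈ L → P (pred x) → P x) → ∀ x ∈ L, P x := by
    intro P h0 h1 x hx
    induction hm : H x generalizing x with
    | zero => have := hH x hx; omega
    | succ m ih =>
      by_cases hp : pred x ∈ L
      · exact h1 x hx hp (ih _ hp (by have := hH x hx; omega))
      · exact h0 x hx hp
  have hmem : ∀ x ∈ L, st x ∈ L ∧ pred (st x) ∉ L := hind _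
    (fun x hx hp => by rw [hst0 x hx hp]; exact ⟨hx, hp⟩)
    (fun x hx hp ih => by rw [hst1 x hx hp]; exact ih)
  have hle : ∀ x ∈ L, H (st x) ≤ H x := hind _
    (fun x hx hp => by rw [hst0 x hx hp])
    (fun x hx hp ih => by
      rw [hst1 x hx hp]
      have := hH x hx
      omega)
  have hix1 : ∀ x ∈ L, pred x ∈ L → H x - H (st x) = H (pred x) - H (st (pred x)) + 1 := by
    intro x hx hp
    have h1 := hH x hx
    have h2 := hle _ hp
    rw [hst1 x hx hp]
    omega
  have hinj : ∀ x ∈ L, ∀ y ∈ L, st x = st y → H x - H (st x) = H y - H (st y) → x = y := by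
    refine hind _ (fun x hx hp y hy h1 h2 => ?_) (fun x hx hp ih y hy h1 h2 => ?_)
    · by_cases hpy : pred y ∈ L
      · have := hix1 y hy hpy
        rw [hst0 x hx hp] at h2
        omega
      · rwa [hst0 x hx hp, hst0 y hy hpy] at h1
    · have h3 := hix1 x hx hp
      by_cases hpy : pred y ∈ L
      · have h4 := hix1 y hy hpy
        have := ih (pred y) hpy (by rw [← hst1 x hx hp, ← hst1 y hy hpy, h1]) (by omega)
        rw [← hsp x hx hp, ← hsp y hy hpy, this]
      · rw [hst0 y hy hpy] at h2
        omega
  let run : V → Finset V := fun s => {x ∈ L | st x = s}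
  -- The indices in a run are distinct and closed downwards.
  have himg : ∀ s, ((run s).image fun x => H x - H (st x)) = range #(run s) := by
    intro s
    have hdown : ∀ x ∈ L, ∀ i ≤ H x - H (st x), ∃ y ∈ L, st y = st x ∧ H y - H (st y) = i := by
      refine hind _ (fun x hx hp i hi => ⟨x, hx, rfl, ?_⟩) (fun x hx hp ih i hi => ?_)
      · rw [hst0 x hx hp] at hi ⊢
        omega
      · rcases Nat.lt_or_ge i (H x - H (st x)) with h | h
        · obtain ⟨y, hy, h1, h2⟩ := ih i (by have := hix1 x hx hp; omega)
          exact ⟨y, hy, by rw [h1, hst1 x hx hp], h2⟩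
        · exact ⟨x, hx, rfl, by omega⟩
    have hcard : #((run s).image fun x => H x - H (st x)) = #(run s) := by
      refine card_image_of_injOn fun x hx y hy hxy => ?_
      simp only [run, coe_filter, Set.mem_ofPred_eq] at hx hy
      exact hinj x hx.1 y hy.1 (hx.2.trans hy.2.symm) hxy
    refine eq_of_subset_of_card_le (fun i hi => ?_) (by rw [card_range, hcard])
    rw [mem_range, ← hcard, Nat.lt_iff_add_one_le, ← card_range (i + 1)]
    refine card_le_card fun j hj => ?_
    simp only [run, mem_image, mem_filter] at hi ⊢
    obtain ⟨x, ⟨hx, rfl⟩, rfl⟩ := hi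
    obtain ⟨y, hy, h1, h2⟩ := hdown x hx j (by rw [mem_range] at hj; omega)
    exact ⟨y, ⟨hy, h1⟩, h2⟩
  have hlt : ∀ x ∈ L, H x - H (st x) < #(run (st x)) := by
    intro x hx
    rw [← mem_range, ← himg, mem_image]
    exact ⟨x, by simp [run, hx], rfl⟩
  have hend : ∀ x ∈ L, succ x ∉ L → H x - H (st x) + 1 = #(run (st x)) := by
    intro x hx hs
    by_contra hne
    have h1 := hlt x hx
    have h2 : H x - H (st x) + 1 ∈ range #(run (st x)) := by rw [mem_range]; omega
    rw [← himg, mem_image] at h2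
    obtain ⟨y, hy, h3⟩ := h2
    simp only [run, mem_filter] at hy
    have hp : pred y ∈ L := by
      by_contra hp
      rw [hst0 y hy.1 hp] at h3
      omega
    have h4 := hix1 y hy.1 hp
    have h5 : pred y = x := hinj _ hp _ hx (by rw [← hst1 y hy.1 hp, hy.2]) (by omega)
    have h6 := hsp y hy.1 hp
    rw [h5] at h6
    exact hs (h6 ▸ hy.1)
  have hlast : ∀ s, ∃ y, s ∈ L → pred s ∉ L → y ∈ L ∧ succ y ∉ L ∧ st y = s := by
    intro s
    by_cases hs : s ∈ L ∧ pred s ∉ L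
    · have hne : (run s).Nonempty := ⟨s, by simp [run, hs.1, hst0 s hs.1 hs.2]⟩
      obtain ⟨y, hy, hmax⟩ := exists_max_image (run s) H hne
      simp only [run, mem_filter] at hy hmax
      refine ⟨y, fun _ _ => ⟨hy.1, fun hsy => ?_, hy.2⟩⟩
      have h1 := hps y hy.1 hsy
      have h2 := hH _ hsy
      have h3 := hst1 _ hsy (by rw [h1]; exact hy.1)
      rw [h1] at h2 h3
      have := hmax (succ y) ⟨hsy, by rw [h3, hy.2]⟩
      omega
    · exact ⟨s, fun h1 h2 => absurd ⟨h1, h2⟩ hs⟩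
  choose last hlast using hlast
  refine ⟨st, fun x => H x - H (st x), fun s => #(run s), last, hmem, fun x hx hp => ?_,
    fun x hx hp => ⟨hst1 x hx hp, hix1 x hx hp⟩, hlt, hinj, fun x hx hs => ⟨hend x hx hs, ?_⟩,
    hlast, fun s => rfl⟩
  · have := hst0 x hx hp
    exact ⟨this, by rw [this]; omega⟩
  · have h1 := hmem x hx
    obtain ⟨h2, h3, h4⟩ := hlast _ h1.1 h1.2
    refine hinj _ h2 _ hx h4 ?_
    have h5 := hend _ h2 h3
    have h6 := hend _ hx hs
    rw [h4] at h5 ⊢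
    omega

/-! ### Counting the vertices of degree two and their runs. -/

namespace Digraph

variable {V : Type*} {T : Digraph V}

theorem underlying_adj {u v : V} : T.underlying.Adj u v ↔ u ≠ v ∧ (T.Adj u v ∨ T.Adj v u) :=
  SimpleGraph.fromRel_adj _ _ _

theorem IsOrientedGraph.ne (hT : T.IsOrientedGraph) {u v : V} (h : T.Adj u v) : u ≠ v := by
  rintro rfl
  exact hT _ _ h h

/-- If bare paths are directed, then a vertex of degree two has one in- and one out-neighbour. -/
theorem exists_pred_succ (hT : T.IsOrientedGraph)
    (hbare : ∀ (u w : V) (p : T.underlying.Walk u w), T.IsBarePath p → T.IsDirectedPath p)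
    {x : V} (hx : T.underlyingDegree x = 2) :
    ∃ a b, T.Adj a x ∧ T.Adj x b ∧ (∀ y, T.Adj y x → y = a) ∧ ∀ y, T.Adj x y → y = b := by
  obtain ⟨a, b, hab, hN⟩ := Set.ncard_eq_two.1 hx
  have ha : T.underlying.Adj a x := by
    have : a ∈ T.underlying.neighborSet x := by rw [hN]; simp
    exact ((SimpleGraph.mem_neighborSet _ _ _).1 this).symm
  have hb : T.underlying.Adj x b := by
    have : b ∈ T.underlying.neighborSet x := by rw [hN]; simp
    exact (SimpleGraph.mem_neighborSet _ _ _).1 this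
  have hnbr : ∀ y, T.Adj x y ∨ T.Adj y x → y = a ∨ y = b := by
    intro y hy
    have hne : x ≠ y := by
      rcases hy with hy | hy
      · exact hT.ne hy
      · exact (hT.ne hy).symm
    have : y ∈ T.underlying.neighborSet x :=
      (SimpleGraph.mem_neighborSet _ _ _).2 (underlying_adj.2 ⟨hne, hy⟩)
    rw [hN] at this
    simpa using this
  -- The path of two edges through `x` is bare, hence directed.
  have hpath : T.IsBarePath (.cons ha (.cons hb .nil)) := by
    refine ⟨?_, fun y hy h1 h2 => ?_⟩
    · simp [SimpleGraph.Walk.isPath_def, ha.ne, hb.ne, hab]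
    · simp at hy
      rcases hy with rfl | rfl | rfl
      · exact absurd rfl h1
      · exact hx
      · exact absurd rfl h2
  rcases (hbare _ _ _ hpath).2 with h | h
  · have h1 : T.Adj a x := h ⟨(a, x), ha⟩ (by simp)
    have h2 : T.Adj x b := h ⟨(x, b), hb⟩ (by simp)
    refine ⟨a, b, h1, h2, fun y hy => ?_, fun y hy => ?_⟩
    · rcases hnbr y (Or.inr hy) with rfl | rfl
      · rfl
      · exact absurd hy (hT _ _ h2)
    · rcases hnbr y (Or.inl hy) with rfl | rfl
      · exact absurd hy (hT _ _ h1)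
      · rfl
  · have h1 : T.Adj x a := h ⟨(a, x), ha⟩ (by simp)
    have h2 : T.Adj b x := h ⟨(x, b), hb⟩ (by simp)
    refine ⟨b, a, h2, h1, fun y hy => ?_, fun y hy => ?_⟩
    · rcases hnbr y (Or.inr hy) with rfl | rfl
      · exact absurd hy (hT _ _ h1)
      · rfl
    · rcases hnbr y (Or.inl hy) with rfl | rfl
      · rfl
      · exact absurd hy (hT _ _ h2)

/-- A tree with `k` leaves has at most `2 k - 2` vertices whose degree is not two. -/
theorem card_degree_ne_two_le [Fintype V] [Nontrivial V] (hT : T.underlying.IsTree) :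
    #{x | T.underlyingDegree x ≠ 2} + 2 ≤ 2 * T.leaves.ncard := by
  have hdeg : ∀ x, T.underlyingDegree x = T.underlying.degree x := by
    intro x
    rw [underlyingDegree, Set.ncard_eq_toFinset_card']
    rfl
  have hleaves : T.leaves.ncard = #{x | T.underlyingDegree x = 1} := by
    rw [← Set.ncard_coe_finset]
    congr 1
    ext x
    simp [leaves]
  have hpos : ∀ x, 0 < T.underlying.degree x := fun x =>
    hT.connected.preconnected.degree_pos_of_nontrivial x
  have h1 := T.underlying.sum_degrees_eq_twice_card_edges
  have h2 := hT.card_edgeFinset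
  -- All degrees are positive, so this holds termwise; the degrees sum to twice the number of edges.
  have h3 : ∑ x : V, (2 + if T.underlyingDegree x ≠ 2 then 1 else 0) ≤
      ∑ x : V, (T.underlying.degree x + 2 * if T.underlyingDegree x = 1 then 1 else 0) := by
    refine sum_le_sum fun x _ => ?_
    have := hpos x
    rw [hdeg]
    split_ifs <;> omega
  rw [sum_add_distrib, sum_add_distrib, ← mul_sum, ← card_filter, ← card_filter, h1, sum_const,
    smul_eq_mul, card_univ, ← hleaves] at h3
  omega

end Digraph

/-- The set of the vertices that are outside of the runs of length at least two in `D`, together with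
the set of the starts of these runs, is at most as large as the set of the vertices outside of `D`
together with the set of the starts of all runs in `D`. -/
theorem card_compl_add_card_starts_le {V : Type*} [Fintype V] {D L : Finset V} {pred succ : V → V}
    (hL : ∀ x, x ∈ L ↔ x ∈ D ∧ (pred x ∈ D ∨ succ x ∈ D))
    (hsp : ∀ x ∈ D, pred x ∈ D → succ (pred x) = x) :
    #Lᶜ + #{x ∈ L | pred x ∉ L} ≤ #Dᶜ + #{x ∈ D | pred x ∉ D} := by
  have h1 : Lᶜ ⊆ Dᶜ ∪ D \ L := by
    intro x hx
    simp only [mem_compl, mem_union, mem_sdiff] at hx ⊢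
    tauto
  -- An element of `D \ L` is a run of length one in `D`, hence its own start.
  have h2 : #(D \ L) + #{x ∈ L | pred x ∉ L} ≤ #{x ∈ D | pred x ∉ D} := by
    rw [← card_union_of_disjoint]
    · refine card_le_card fun x hx => ?_
      simp only [mem_union, mem_sdiff, mem_filter] at hx ⊢
      rcases hx with ⟨hx, hxL⟩ | ⟨hx, hp⟩
      · rw [hL] at hxL
        tauto
      · have hxD := ((hL x).1 hx).1
        refine ⟨hxD, fun hpD => hp ?_⟩
        rw [hL]
        exact ⟨hpD, Or.inr (by rwa [hsp x hxD hpD])⟩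
    · rw [disjoint_left]
      intro x hx hx'
      simp only [mem_sdiff, mem_filter] at hx hx'
      exact hx.2 hx'.1
  have h3 := (card_le_card h1).trans (card_union_le _ _)
  omega

/-- The edges leaving `D` vertices differ from those entering starts of runs, whose tails are
outside `D`. Consequently `D` has fewer runs than there are vertices outside `D`. -/
theorem IsRootedBy.card_add_card_starts_lt {V : Type*} [Fintype V] {Adj : V → V → Prop}
    {par : V → V} {d : V → ℕ} (hpar : IsRootedBy Adj par d) (hor : ∀ u v, Adj u v → ¬ Adj v u)
    (hroot : ∃ root, d root = 0) {D : Finset V} {pred succ : V → V}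
    (hpred : ∀ x ∈ D, Adj (pred x) x) (hsucc : ∀ x ∈ D, Adj x (succ x)) :
    #D + #{x ∈ D | pred x ∉ D} < Fintype.card V := by
  refine lt_of_le_of_lt ?_ (hpar.card_edges_lt hor hroot)
  rw [← card_image_of_injective D (f := fun x => (x, succ x)) fun a b h => (Prod.mk.inj h).1,
    ← card_image_of_injective (f := fun x => (pred x, x)) _ fun a b h => (Prod.mk.inj h).2,
    ← card_union_of_disjoint]
  · refine card_le_card fun z hz => ?_
    simp only [mem_union, mem_image, mem_filter] at hz
    rcases hz with ⟨x, hx, rfl⟩ | ⟨x, hx, rfl⟩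
    · simpa using hsucc x hx
    · simpa using hpred x hx.1
  · rw [disjoint_left]
    intro z hz hz'
    simp only [mem_image, mem_filter] at hz hz'
    obtain ⟨x, hx, rfl⟩ := hz
    obtain ⟨y, hy, h⟩ := hz'
    exact hy.2 ((Prod.mk.inj h).1 ▸ hx)

/-! ### Assembling the forests and the runs. -/

theorem sum_range_sum_filter_le {V : Type*} (S : Finset V) (lv c : V → ℕ) (n : ℕ) :
    ∑ t ∈ range n, ∑ x ∈ S with lv x = t, c x ≤ ∑ x ∈ S, c x := by
  simp_rw [sum_filter]
  rw [sum_comm]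
  refine sum_le_sum fun x _ => ?_
  rw [sum_ite_eq]
  split_ifs <;> simp

/-- An oriented forest embeds in a median order, where the room that is needed beyond the number of
vertices depends only on the number of vertices outside of `L` and on the number of runs in `L`. -/
theorem IsMedianOrder.exists_embedding {V : Type*} [Fintype V] [Nonempty V] {E : ℕ → ℕ → Prop}
    (hE : IsMedianOrder E) {Adj : V → V → Prop} {par : V → V} {d : V → ℕ}
    (hpar : IsRootedBy Adj par d) (hor : ∀ u v, Adj u v → ¬ Adj v u) {L : Finset V}
    {pred succ : V → V} (hpred : ∀ x ∈ L, Adj (pred x) x ∧ ∀ y, Adj y x → y = pred x)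
    (hsucc : ∀ x ∈ L, Adj x (succ x) ∧ ∀ y, Adj x y → y = succ x)
    (hlong : ∀ x ∈ L, pred x ∈ L ∨ succ x ∈ L) :
    ∃ f : V → ℕ, Function.Injective f ∧
      (∀ x, f x < Fintype.card V + 11 * (#Lᶜ + #{x ∈ L | pred x ∉ L})) ∧
      ∀ u v, Adj u v → E (f u) (f v) := by
  obtain ⟨H, hH⟩ := hpar.exists_potential hor fun _ _ => 1
  -- The level rises only on entering a run, so a run leaving `K t` has level `t + 1` and ends
  -- before a vertex of `K (t + 1)`.
  obtain ⟨lv, hlv⟩ := hpar.exists_potential hor fun u v => if u ∉ L ∧ v ∈ L then 1 else 0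
  have hps : ∀ x ∈ L, succ x ∈ L → pred (succ x) = x := fun x hx hs =>
    ((hpred _ hs).2 x (hsucc x hx).1).symm
  obtain ⟨st, ix, len, last, hrun⟩ := exists_isRunDecomposition (L := L) (pred := pred)
    (succ := succ) (H := H) (fun x hx => hH _ _ (hpred x hx).1)
    (fun x hx hp => ((hsucc _ hp).2 x (hpred x hx).1).symm) hps
  -- levels
  have hlv0 : ∀ x ∈ L, pred x ∉ L → lv x = lv (pred x) + 1 := fun x hx hp => by
    rw [hlv _ _ (hpred x hx).1, if_pos ⟨hp, hx⟩]
  have hlv1 : ∀ x ∈ L, pred x ∈ L → lv x = lv (pred x) := fun x hx hp => by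
    rw [hlv _ _ (hpred x hx).1, if_neg (fun h => h.1 hp), Nat.add_zero]
  have hlvst : ∀ x ∈ L, lv x = lv (st x) := by
    intro x hx
    induction hm : ix x generalizing x with
    | zero =>
      by_cases hp : pred x ∈ L
      · have := (hrun.of_pred x hx hp).2
        omega
      · rw [(hrun.of_start x hx hp).1]
    | succ m ih =>
      by_cases hp : pred x ∈ L
      · have := hrun.of_pred x hx hp
        rw [this.1, hlv1 x hx hp]
        exact ih _ hp (by omega)
      · rw [(hrun.of_start x hx hp).1]
  have hlen : ∀ s ∈ L, pred s ∉ L → 2 ≤ len s := by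
    intro s hs hp
    have hss := (hlong s hs).resolve_left hp
    have h1 := hrun.of_pred _ hss (by rw [hps s hs hss]; exact hs)
    have h2 := hrun.ix_lt _ hss
    rw [hps s hs hss, (hrun.of_start s hs hp).1] at h1
    rw [h1.1] at h2
    omega
  let K : ℕ → Finset V := fun t => {x ∈ Lᶜ | lv x = t}
  let A : ℕ → Finset V := fun t => {s ∈ {x ∈ L | pred x ∉ L} | lv s - 1 = t}
  have hK : ∀ x t, x ∈ K t ↔ x ∉ L ∧ lv x = t := fun x t => by simp [K]
  have hA : ∀ s t, s ∈ A t ↔ (s ∈ L ∧ pred s ∉ L) ∧ lv s = t + 1 := fun s t => by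
    simp only [A, mem_filter]
    refine and_congr_right fun h => ?_
    have := hlv0 s h.1 h.2
    omega
  let R : ℕ → ℕ := fun t => ∑ s ∈ A t, (len s - 2 + 13)
  -- Block `t` has length `4 * #(K t)`. The gap behind it has length `4 * #(K t)`, for `p - a` in
  -- `exists_paths_between`, plus `4 * #(K (t + 1))`, for `w`, plus the weights `R t` of the runs.
  obtain ⟨B, hB0, hBs⟩ : ∃ B : ℕ → ℕ, B 0 = 0 ∧
      ∀ t, B (t + 1) = B t + 8 * #(K t) + 4 * #(K (t + 1)) + R t :=
    ⟨fun t => Nat.rec 0 (fun t b => b + 8 * #(K t) + 4 * #(K (t + 1)) + R t) t, rfl,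
      fun _ => rfl⟩
  choose fK hKinj hKmem hKadj hKobs using fun t =>
    hE.exists_forest_embedding hpar hor (K t) (B t)
  have hpredK : ∀ t, ∀ s ∈ A t, pred s ∈ K t := by
    intro t s hs
    rw [hA] at hs
    rw [hK]
    have := hlv0 s hs.1.1 hs.1.2
    exact ⟨hs.1.2, by omega⟩
  have hlastK : ∀ t, ∀ s ∈ A t, succ (last s) ∈ K (t + 1) := by
    intro t s hs
    rw [hA] at hs
    obtain ⟨h1, h2, h3⟩ := hrun.last_mem s hs.1.1 hs.1.2
    rw [hK, hlv _ _ (hsucc _ h1).1, if_neg (fun h => h.1 h1), hlvst _ h1, h3]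
    exact ⟨h2, hs.2⟩
  have hpaths : ∀ t, ∃ q, IsPathSystem E (fun s => fK (t + 1) (succ (last s)))
      ((K (t + 1)).image (fK (t + 1))) (A t) (fun s => fK t (pred s)) (fun s => len s - 2) ∅
      (B t + 4 * #(K t)) q := by
    intro t
    refine hE.exists_paths_between (a := B t) (b := B (t + 1)) (w := 4 * #(K (t + 1)))
      (fun s hs => hKmem t _ (hpredK t s hs)) (fun x hx => ?_)
      (fun s hs => ⟨(hKmem _ _ (hlastK t s hs)).1, hKobs _ _ (hlastK t s hs)⟩) ?_
    · obtain ⟨y, hy, rfl⟩ := mem_image.1 hx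
      exact (hKmem _ _ hy).1
    · have := hBs t
      simp only [R] at this
      omega
  choose q hq using hpaths
  let f : V → ℕ := fun x => if x ∈ L then q (lv x - 1) (st x) (ix x) else fK (lv x) x
  have hfK : ∀ x, x ∉ L → f x = fK (lv x) x := fun x hx => if_neg hx
  have hfL : ∀ x t, x ∈ L → lv x = t + 1 → f x = q t (st x) (ix x) := fun x t hx ht => by
    simp only [f, if_pos hx, ht, Nat.add_sub_cancel]
  have hxK : ∀ x, x ∉ L → x ∈ K (lv x) := fun x hx => (hK _ _).2 ⟨hx, rfl⟩
  have hxL : ∀ x ∈ L, ∃ t, lv x = t + 1 ∧ st x ∈ A t ∧ ix x < len (st x) - 2 + 2 ∧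
      2 ≤ len (st x) := by
    intro x hx
    obtain ⟨h1, h2⟩ := hrun.start_mem x hx
    have h3 := hlv0 _ h1 h2
    have h4 := hlen _ h1 h2
    have h5 := hrun.ix_lt x hx
    rw [← hlvst x hx] at h3
    refine ⟨lv (pred (st x)), h3, (hA _ _).2 ⟨⟨h1, h2⟩, ?_⟩, by omega, h4⟩
    rw [← hlvst x hx, h3]
  -- the ends of the levels
  let En : ℕ → ℕ := fun t => B t + 4 * #(K t)
  have hEnB : ∀ t, En t ≤ B (t + 1) := fun t => by
    have := hBs t
    simp only [En]
    omega
  have hEn : Monotone En := monotone_nat_of_le_succ fun t =>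
    (hEnB t).trans (Nat.le_add_right _ _)
  have hupper : ∀ x, f x < En (lv x) := by
    intro x
    by_cases hx : x ∈ L
    · obtain ⟨t, ht, hst, hix, -⟩ := hxL x hx
      rw [hfL x t hx ht, ht]
      exact ((hq t).mem _ hst _ hix).2.1.trans (hKmem _ _ (hlastK t _ hst)).2
    · rw [hfK x hx]
      exact (hKmem _ _ (hxK x hx)).2
  have hlower : ∀ x t, t < lv x → En t ≤ f x := by
    intro x t hlt
    by_cases hx : x ∈ L
    · obtain ⟨t', ht', hst, hix, -⟩ := hxL x hx
      rw [hfL x t' hx ht']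
      exact (hEn (by omega : t ≤ t')).trans ((hq t').mem _ hst _ hix).1
    · rw [hfK x hx]
      obtain ⟨t', ht'⟩ : ∃ t', lv x = t' + 1 := ⟨lv x - 1, by omega⟩
      have h1 := (hKmem _ _ (hxK x hx)).1
      rw [ht'] at h1 ⊢
      exact (hEn (by omega : t ≤ t')).trans ((hEnB t').trans h1)
  refine ⟨f, fun x y hxy => ?_, fun x => ?_, fun u v huv => ?_⟩
  · have hlvxy : lv x = lv y := by
      rcases lt_trichotomy (lv x) (lv y) with h | h | h
      · have h1 := hupper x
        have h2 := hlower y _ h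
        omega
      · exact h
      · have h1 := hupper y
        have h2 := hlower x _ h
        omega
    have mixed : ∀ x y, lv x = lv y → x ∈ L → y ∉ L → f x ≠ f y := by
      intro x y hlvxy hx hy hxy
      obtain ⟨t, ht, hst, hix, -⟩ := hxL x hx
      have h1 := ((hq t).mem _ hst _ hix).2.2.2
      rw [← hfL x t hx ht, hxy, hfK y hy, ← hlvxy, ht] at h1
      refine h1 (mem_image_of_mem _ ?_)
      have := hxK y hy
      rwa [← hlvxy, ht] at this
    by_cases hx : x ∈ L <;> by_cases hy : y ∈ L
    · obtain ⟨t, ht, hst, hix, -⟩ := hxL x hx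
      obtain ⟨t', ht', hst', hix', -⟩ := hxL y hy
      obtain rfl : t = t' := by omega
      rw [hfL x t hx ht, hfL y t hy ht'] at hxy
      have := (hq t).inj _ hst _ hst' _ hix _ hix' hxy
      exact hrun.ix_inj x hx y hy this.1 this.2
    · exact absurd hxy (mixed x y hlvxy hx hy)
    · exact absurd hxy.symm (mixed y x hlvxy.symm hy hx)
    · rw [hfK x hx, hfK y hy, ← hlvxy] at hxy
      refine hKinj (lv x) (hxK x hx) ?_ hxy
      rw [hlvxy]
      exact hxK y hy
  · refine (hupper x).trans_le ?_
    -- A vertex outside `L` pays `12`: four for its block and four for each of the adjacent gaps.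
    have hsum : ∀ t, En t + 4 * #(K t) ≤
        12 * ∑ i ∈ range (t + 1), #(K i) + ∑ i ∈ range t, R i := by
      intro t
      induction t with
      | zero => simp [En, hB0]; omega
      | succ t ih =>
        rw [sum_range_succ _ (t + 1), sum_range_succ R t]
        have h1 := hBs t
        simp only [En] at ih ⊢
        omega
    have h1 : ∑ i ∈ range (lv x + 1), #(K i) ≤ #Lᶜ := by
      have := sum_range_sum_filter_le Lᶜ lv (fun _ => 1) (lv x + 1)
      simpa [K] using this
    have h2 : ∑ i ∈ range (lv x), R i ≤ ∑ s ∈ L with pred s ∉ L, (len s - 2 + 13) :=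
      sum_range_sum_filter_le _ (fun s => lv s - 1) (fun s => len s - 2 + 13) (lv x)
    have h3 : ∑ s ∈ L with pred s ∉ L, (len s - 2 + 13) =
        ∑ s ∈ L with pred s ∉ L, (len s + 11) := by
      refine sum_congr rfl fun s hs => ?_
      rw [mem_filter] at hs
      have := hlen s hs.1 hs.2
      omega
    have h4 : ∑ s ∈ L with pred s ∉ L, len s = #L := by
      rw [card_eq_sum_card_fiberwise (f := st) (t := {s ∈ L | pred s ∉ L})]
      · exact sum_congr rfl fun s _ => hrun.len_eq s
      · intro y hy
        exact mem_filter.2 (hrun.start_mem y hy)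
    rw [h3, sum_add_distrib, h4, sum_const, smul_eq_mul] at h2
    have h5 := hsum (lv x)
    have h6 := card_add_card_compl L
    omega
  · by_cases hu : u ∈ L <;> by_cases hv : v ∈ L
    · obtain rfl := (hpred v hv).2 u huv
      obtain ⟨t, ht, hst, hix, -⟩ := hxL v hv
      have h1 := hrun.of_pred v hv hu
      have h2 := hlv1 v hv hu
      rw [hfL _ t hu (by omega), hfL _ t hv ht, ← h1.1, h1.2]
      exact (hq t).step _ hst _ (by omega)
    · obtain rfl := (hsucc u hu).2 v huv
      obtain ⟨t, ht, hst, hix, hlen2⟩ := hxL u hu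
      obtain ⟨h1, h2⟩ := hrun.of_succ u hu hv
      have h3 := hlv u _ huv
      rw [if_neg (fun h => h.1 hu), Nat.add_zero] at h3
      have h4 := (hq t).last _ hst
      rw [h2, show len (st u) - 2 + 1 = ix u by omega] at h4
      rw [hfL _ t hu ht, hfK _ hv, h3, ht]
      exact h4
    · obtain rfl := (hpred v hv).2 u huv
      obtain ⟨t, ht, hst, hix, -⟩ := hxL v hv
      have h1 := hrun.of_start v hv hu
      have h2 := hlv0 v hv hu
      have h3 := (hq t).first _ hst
      rw [hfL _ t hv ht, hfK _ hu, h1.2, show lv (pred v) = t by omega]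
      rw [h1.1] at h3 ⊢
      exact h3
    · have h1 := hlv u v huv
      rw [if_neg (fun h => hv h.2), Nat.add_zero] at h1
      rw [hfK _ hu, hfK _ hv, h1]
      refine hKadj _ u (hxK u hu) v ?_ huv
      rw [← h1]
      exact hxK v hv

theorem theorem3p1 {V W : Type*} [Finite V] [Finite W] (n k : ℕ)
    (T : Digraph V) (hT : T.IsOrientedTree) (hn : Nat.card V = n) (hk : T.leaves.ncard = k)
    (hbare : ∀ (u w : V) (p : T.underlying.Walk u w), T.IsBarePath p → T.IsDirectedPath p)
    (G : Digraph W) (hG : G.IsTournament) (hcard : Nat.card W = n + 50 * k) :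
    G.ContainsCopy T := by
  have := Fintype.ofFinite V
  have := Fintype.ofFinite W
  have hne : Nonempty V := hT.2.connected.nonempty
  rw [Nat.card_eq_fintype_card] at hn hcard
  -- In a tree with one vertex the degree is zero, and the degree count does not apply.
  rcases subsingleton_or_nontrivial V with hV | hV
  · have hW : 0 < Fintype.card W := by
      have := Fintype.card_pos (α := V)
      omega
    obtain ⟨w⟩ := Fintype.card_pos_iff.1 hW
    exact ⟨fun _ => w, Function.injective_of_subsingleton _, fun u v huv =>
      absurd (Subsingleton.elim u v) (hT.1.ne huv)⟩
  obtain ⟨E, hE, e, he, hEG⟩ := hG.exists_isMedianOrder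
  obtain ⟨par, d, hpar', hroot⟩ := hT.2.exists_isRootedBy
  have hpar : IsRootedBy T.Adj par d := fun u v huv =>
    hpar' u v (Digraph.underlying_adj.2 ⟨hT.1.ne huv, Or.inl huv⟩)
  let D : Finset V := {x | T.underlyingDegree x = 2}
  have hps : ∀ x, ∃ a b, x ∈ D → T.Adj a x ∧ T.Adj x b ∧ (∀ y, T.Adj y x → y = a) ∧
      ∀ y, T.Adj x y → y = b := by
    intro x
    by_cases hx : x ∈ D
    · obtain ⟨a, b, h⟩ := Digraph.exists_pred_succ hT.1 hbare (mem_filter.1 hx).2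
      exact ⟨a, b, fun _ => h⟩
    · exact ⟨x, x, fun h => absurd h hx⟩
  choose pred succ hps using hps
  -- Runs of one vertex are left to the forests, since the embedded paths have at least two interior
  -- vertices.
  let L : Finset V := {x ∈ D | pred x ∈ D ∨ succ x ∈ D}
  have hL : ∀ x, x ∈ L ↔ x ∈ D ∧ (pred x ∈ D ∨ succ x ∈ D) := fun x => mem_filter
  have hsp : ∀ x ∈ D, pred x ∈ D → succ (pred x) = x := fun x hx hp =>
    ((hps _ hp).2.2.2 x (hps x hx).1).symm
  have hps' : ∀ x ∈ D, succ x ∈ D → pred (succ x) = x := fun x hx hs =>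
    ((hps _ hs).2.2.1 x (hps x hx).2.1).symm
  obtain ⟨f, hinj, hlt, hadj⟩ := hE.exists_embedding hpar hT.1 (L := L) (pred := pred)
    (succ := succ) (fun x hx => have h := hps x ((hL x).1 hx).1; ⟨h.1, h.2.2.1⟩)
    (fun x hx => have h := hps x ((hL x).1 hx).1; ⟨h.2.1, h.2.2.2⟩) (fun x hx => by
      obtain ⟨hxD, hx | hx⟩ := (hL x).1 hx
      · exact Or.inl ((hL _).2 ⟨hx, Or.inr (by rwa [hsp x hxD hx])⟩)
      · exact Or.inr ((hL _).2 ⟨hx, Or.inl (by rwa [hps' x hxD hx])⟩))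
  have h1 := card_compl_add_card_starts_le hL hsp
  have h2 := hpar.card_add_card_starts_lt hT.1 hroot (D := D) (fun x hx => (hps x hx).1)
    (fun x hx => (hps x hx).2.1)
  have h3 := Digraph.card_degree_ne_two_le hT.2
  have h4 : Dᶜ = ({x | T.underlyingDegree x ≠ 2} : Finset V) := by
    ext x
    simp [D]
  have h5 := card_add_card_compl D
  rw [← h4, hk] at h3
  -- By `h2` and `h5` there are fewer starts in `D` than vertices in `Dᶜ`, and `#Dᶜ ≤ 2 * k - 2` by
  -- `h3`. So the surplus is at most `11 * (4 * k - 5)`, below `50 * k`.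
  have hlt' : ∀ x, f x < Fintype.card W := fun x => (hlt x).trans_le (by omega)
  refine ⟨fun x => e ⟨f x, hlt' x⟩, fun x y hxy => hinj (Fin.mk.inj_iff.1 (he hxy)),
    fun u v huv => hEG _ _ (hadj u v huv)⟩
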